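/- **SortingLSH routing.** Let $P$ be a set of $n\ge 1$ points of $\mathbb{R}^d$ with the $\ell_\rho$ norm, $\rho\in[1,2]$, partitioned into shards. For $1\le k\le n$ let $\pi_k(q)$ be the distance from $q$ to its $k$-th nearest neighbor in $P$. Let $\mathcal H$ be a probability distribution over functions $h:\mathbb{R}^d\to\{0,1\}$, and let $r$, $t$, $W\ge 1$, $1\le m\le n$ be integers. Sample an $m$-element subset $R\subseteq P$ uniformly at random. For each $j\le r$ draw independent $h_{j,1},\dots,h_{j,t}\sim\mathcal H$ and sort $R$ lexicographically by the keys $(h_{j,1}(x),\dots,h_{j,t}(x))$. Given $q$, for each $j$ take the position $\tau_j$ of a point whose key shares a longest prefix with the key of $q$; let $Q$ be the set of all points at positions in $[\tau_j-W,\tau_j+W]$, $j\le r$. Then $q$ is routed to the top shard: under *distance ranking*, a shard containing a point of $Q$ closest to $q$; under *voting*, a shard $S$ maximizing $\sum_{v\in Q\cap S}e^{-\sigma\|q-v\|_\rho^2}$, where the scaling factor $\sigma<\infty$ is normalized by the nearest retrieved point, $\sigma\cdot\min_{v\in Q}\|q-v\|_\rho^2\ge 1$ (if that minimum is $0$, then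 $\sigma=\infty$: exactly the points at distance $0$ have a nonzero vote, namely $1$). All ties are broken arbitrarily. Call $\mathcal H$ *locality sensitive with distortion $C$ up to distance $\Delta$* if for some $\lambda>0$ and all $x,y\in\mathbb{R}^d$, $$1-\lambda\|x-y\|_\rho\ \le\ \Pr_{h\sim\mathcal H}[h(x)=h(y)]\ \le\ 1-\tfrac{\lambda}{C}\min\{\|x-y\|_\rho,\Delta\}.$$ **Theorem.** There are universal constants $A>0$, $C\ge1$ such that for all $c>1$ and $\kappa\in\mathbb{N}$ there is a constant $B=B(c,\kappa)>0$, and for every window size $W\ge1$ a number $N=N(c,\kappa,W)$, with the following property. For all $\rho\in[1,2]$, $d$, and $P\subset\mathbb{R}^d$ of finite size $n\ge1$ there are a family $\mathcal H$, locality sensitive with distortion $C$ up to distance $\operatorname{diam}(P)$, and a number $t$ such that SortingLSH routing with $r=\lceil B\,n^{1/c}\rceil$ repetitions satisfies, for every partition of $P$ into shards and every query $q\in\mathbb{R}^d$: - If $m=n$, then with probability at least $1-n^{-\kappa}$, $q$ is routed to a shard containing a point $p\in P$ with $\|p-q\|_\rho\le\alpha\,\pi_1(q)$. - If $1\le m<n$,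 then for every $\delta\in(0,1)$ with $k:=\lceil\log(1/\delta)\,n/m\rceil\le n$, with probability at least $1-\max\{\delta,n^{-\kappa}\}$, $q$ is routed to a shard containing a point $p\in P$ with $\|p-q\|_\rho\le\alpha\,\pi_k(q)$. Here $\alpha=A\,c$ for distance ranking (all $n$), and $\alpha=A\sqrt{c\log n}$ for voting (all $n\ge N$). -/

import Mathlib

open MeasureTheory
open scoped ENNReal

noncomputable section

namespace SortLSH

/-- `ℝ^d` with the `ℓ_ρ` norm. -/
abbrev LpSpace (ρ : ℝ≥0∞) (d : ℕ) : Type := PiLp ρ (fun _ : Fin d => ℝ)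

section Hashing

variable {X : Type*} [MetricSpace X]

/-- `H` is a probability distribution over hash functions `X → {0,1}` which is locality sensitive
with distortion `C` at distances up to `Δ`: for some `lam > 0` the probability that two points are
separated is at most `lam` times their distance, and at least `lam / C` times their distance
(truncated at `Δ`). -/
structure IsLSHFamily (H : Measure (X → Bool)) (C Δ : ℝ) : Prop where
  isProbabilityMeasure : IsProbabilityMeasure H
  sensitive : ∃ lam : ℝ, 0 < lam ∧ ∀ x y : X,
    1 - lam * dist x y ≤ H.real {h | h x = h y} ∧
    H.real {h | h x = h y} ≤ 1 - lam * min (dist x y) Δ / C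

/-- The law of the `r × t` independent hash functions `h_{j,i}` drawn from `H`. -/
def hashLaw (H : Measure (X → Bool)) (r t : ℕ) : Measure (Fin r → Fin t → X → Bool) :=
  Measure.pi fun _ => Measure.pi fun _ => H

/-- The sorting key `(h_1(x), …, h_t(x))`, an element of `{0,1}^t` in lexicographic order. -/
def key {t : ℕ} (h : Fin t → X → Bool) (x : X) : Lex (Fin t → Bool) :=
  toLex fun i => h i x

/-- The keys of `x` and `y` agree on their first `l` bits. -/
def SharePrefix {t : ℕ} (h : Fin t → X → Bool) (l : ℕ) (x y : X) : Prop :=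
  ∀ i : Fin t, (i : ℕ) < l → h i x = h i y

/-- `I` lists the points of `R`, each once, sorted lexicographically by key
(points with equal keys may come in any order). -/
structure IsSortedIndex {t : ℕ} (h : Fin t → X → Bool) (R : Finset X)
    (I : Fin R.card → X) : Prop where
  injective : Function.Injective I
  range_eq : Set.range I = (R : Set X)
  sorted : Monotone fun a => key h (I a)

/-- `τ` is the position of a point lexicographically closest to `q`: no point of the index shares a
longer key prefix with `q` than the point at position `τ`. -/
def IsClosestPosition {t N : ℕ} (h : Fin t → X → Bool) (I : Fin N → X) (q : X)
    (τ : Fin N) : Prop :=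
  ∀ (a : Fin N) (l : ℕ), SharePrefix h l (I a) q → SharePrefix h l (I τ) q

/-- `Q` is a set that the SortingLSH index on `R` may retrieve for the query `q`: the union over the
`r` repetitions of the windows `[τ_j - W, τ_j + W]`. -/
def IsRetrieved {r t : ℕ} (h : Fin r → Fin t → X → Bool) (R : Finset X) (W : ℕ) (q : X)
    (Q : Finset X) : Prop :=
  ∃ (I : Fin r → Fin R.card → X) (τ : Fin r → Fin R.card),
    (∀ j, IsSortedIndex (h j) R (I j)) ∧
    (∀ j, IsClosestPosition (h j) (I j) q (τ j)) ∧
    ∀ x, x ∈ Q ↔ ∃ (j : Fin r) (a : Fin R.card),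
      (τ j : ℕ) ≤ a + W ∧ (a : ℕ) ≤ τ j + W ∧ I j a = x

/-- Distance from `q` to the nearest point of `Q` (`∞` if `Q` is empty). -/
def minDist (Q : Finset X) (q : X) : ℝ≥0∞ := ⨅ v ∈ Q, edist q v

/-- Distance ranking: shard `i` is (one of) the first in the order by distance to the closest
retrieved point of the shard. -/
def TopByDistance {s : ℕ} (shard : X → Fin s) (q : X) (Q : Finset X) (i : Fin s) : Prop :=
  ∀ j, minDist (Q.filter fun v => shard v = i) q ≤ minDist (Q.filter fun v => shard v = j) q

/-- The vote `exp (-σ d(q,v)²)`. -/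
def vote (σ : ℝ≥0∞) (q v : X) : ℝ≥0∞ :=
  EReal.exp (-((σ * edist q v ^ 2 : ℝ≥0∞) : EReal))

/-- The voting power of shard `i`: the total vote of the retrieved points of the shard. -/
def votingPower {s : ℕ} (shard : X → Fin s) (σ : ℝ≥0∞) (q : X) (Q : Finset X)
    (i : Fin s) : ℝ≥0∞ :=
  ∑ v ∈ Q.filter (fun v => shard v = i), vote σ q v

/-- The scaling factor is normalized by the nearest retrieved point, at distance `D`:
`σ D² ≥ 1` and `σ` is finite, except that `σ = ∞` if `D = 0` (then exactly the retrieved points at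
distance `0` from `q` have a nonzero vote). -/
def IsScale (q : X) (Q : Finset X) (σ : ℝ≥0∞) : Prop :=
  (minDist Q q ^ 2)⁻¹ ≤ σ ∧ (σ = ⊤ → minDist Q q = 0)

/-- Voting: shard `i` is (one of) the first in the order by decreasing voting power. -/
def TopByVotes {s : ℕ} (shard : X → Fin s) (q : X) (Q : Finset X) (i : Fin s) : Prop :=
  ∃ σ, IsScale q Q σ ∧ ∀ j, votingPower shard σ q Q j ≤ votingPower shard σ q Q i

/-- The distance `π_k(q)` from `q` to its `k`-th nearest neighbor in `P`, for `1 ≤ k ≤ |P|`. -/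
def kthDist (P : Finset X) (q : X) (k : ℕ) : ℝ :=
  sInf {u : ℝ | k ≤ (P.filter fun p => dist p q ≤ u).card}

/-- The event that `q` may be routed, by the scheme `Top`, to a shard with no point of `P` within
distance `u` of `q`. -/
def Misrouted {r t s : ℕ} (h : Fin r → Fin t → X → Bool) (P R : Finset X) (W : ℕ)
    (shard : X → Fin s) (Top : Finset X → Fin s → Prop) (q : X) (u : ℝ) : Prop :=
  ∃ (Q : Finset X) (i : Fin s), IsRetrieved h R W q Q ∧ Top Q i ∧
    ∀ p ∈ P, shard p = i → u < dist p q

/-- The probability of `Misrouted`, over a uniformly random `m`-element subset `R` of `P` and,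
independently of `R`, the hash functions. -/
def failProb (H : Measure (X → Bool)) (r t : ℕ) (P : Finset X) (m W : ℕ) {s : ℕ}
    (shard : X → Fin s) (Top : Finset X → Fin s → Prop) (q : X) (u : ℝ) : ℝ≥0∞ :=
  (∑ R ∈ P.powersetCard m, hashLaw H r t {h | Misrouted h P R W shard Top q u}) /
    (P.powersetCard m).card

end Hashing

end SortLSH

end

/-!
The routing fails only if the sample `R` contains none of the `k` nearest neighbors of `q`, or if
the index on `R` contains a point `p` at distance `u ≤ π_k(q)` but retrieves only points at
distance more than `γ u`, where `γ = 48 C c`.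

*Hashing.* Let `L = log n`. There is a prefix length `l` at which `p` shares the prefix of `q`
with probability `(1 - lam u) ^ l ≥ n ^ (-1/(2c))`, while each point farther than `γ u` does so
with probability at most `n ^ (-3)` (`exists_prefix_length`). If `p` shares the prefix and no far
point does, then the point at the position `τ_j` is not far, whatever the window. This happens in
one repetition with probability at least `n ^ (-1/(2c)) / 2`, hence in one of `B n ^ (1/c)`
repetitions except with probability `n ^ (-(κ + 4))` (`hashLaw_far_le`). The keys must be long
enough to separate the points of `P`, which settles the queries with tiny or zero `u`; the
truncation of the distances at the diameter is harmless, because a point of `P` farther than `γ u`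
from `q` forces the diameter to be at least `(γ - 1) u`.

*Ranking.* Under distance ranking a retrieved point within `γ u` suffices. Under voting, the vote
of the nearest retrieved point outweighs all votes from beyond distance `a γ u` together if
`a ^ 2 - 1` exceeds the logarithm of the number of retrieved points, which is `(1/c) log n + O(1)`
(`TopByVotes.exists_near`).

*Sampling.* The sample misses the `k` nearest neighbors with probability at most `(1 - k/n) ^ m`,
which is below `exp (-k m / n) ≤ δ` by a factor `1 - 1/(4 n ^ 2)`; the difference pays for the
failure probability of the hashing (`card_powersetCard_miss_le`, `failProb_bounds`).

*The hash family* (`exists_isLSHFamily`). A random linear functional `ω` whose mean absolute value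
at `z` is `‖z‖_ρ` up to universal constants yields a family: round `⟨ω, x⟩` to a randomly shifted
grid of large width and toss a fair coin for each cell. For `ρ = 1`, `ω` is a random coordinate.
For `ρ > 1`, the coordinates of `ω` are independent with a symmetric law whose characteristic
function `φ` satisfies `1 - φ(t) ≍ |t| ^ ρ`, up to universal constants, near `0`; then the mean of
`|⟨ω, z⟩|` is computed from `|x| = const * ∫ (1 - cos (t x)) / t ^ 2`
(`lintegral_abs_pi_heavy_bounds`). To have constants uniform in `ρ`, the law mixes a Pareto law of
exponent `ρ`, whose truncated second moment explodes as `ρ → 2`, with a unit mass, in the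
proportion `2 - ρ` to `ρ - 1`.
-/

namespace SortLSH

/-! ### A heavy-tailed law and its characteristic function -/

lemma one_sub_cos_ge {x : ℝ} (hx : |x| ≤ 1) : x ^ 2 / 5 ≤ 1 - Real.cos x := by
  have h := Real.cos_le_one_sub_mul_cos_sq (x := x) (by linarith [Real.pi_gt_three])
  have h5 : 1 / 5 ≤ 2 / Real.pi ^ 2 := by
    rw [div_le_div_iff₀ (by norm_num) (by positivity)]
    nlinarith [Real.pi_lt_d2, Real.pi_gt_three]
  nlinarith [mul_le_mul_of_nonneg_right h5 (sq_nonneg x)]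

/-- The law on `[1, ∞)` which is, with weight `2 - ρ`, that of `U ^ (-1/ρ)` for a uniform `U` on
`(0, 1]` (a Pareto law with exponent `ρ`), and, with weight `ρ - 1`, the unit mass at `1`. -/
noncomputable def heavyHalf (ρ : ℝ) : Measure ℝ :=
  ENNReal.ofReal (2 - ρ) • (volume.restrict (Set.Ioc (0 : ℝ) 1)).map (fun u => u ^ (-ρ⁻¹)) +
    ENNReal.ofReal (ρ - 1) • Measure.dirac 1

/-- The symmetrization of `heavyHalf ρ`. -/
noncomputable def heavy (ρ : ℝ) : Measure ℝ :=
  (2⁻¹ : ℝ≥0∞) • (heavyHalf ρ + (heavyHalf ρ).map Neg.neg)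

/-- The cosine transform of `heavyHalf ρ`; it is the characteristic function of `heavy ρ`. -/
noncomputable def heavyCos (ρ t : ℝ) : ℝ := ∫ x, Real.cos (t * x) ∂heavyHalf ρ

lemma isProbabilityMeasure_heavyHalf {ρ : ℝ} (h1 : 1 ≤ ρ) (h2 : ρ ≤ 2) :
    IsProbabilityMeasure (heavyHalf ρ) := by
  constructor
  rw [heavyHalf, Measure.add_apply, Measure.smul_apply, Measure.smul_apply,
    Measure.map_apply (by fun_prop) MeasurableSet.univ]
  simp only [Set.preimage_univ, Measure.restrict_apply_univ, Real.volume_Ioc, measure_univ,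
    smul_eq_mul, mul_one]
  rw [sub_zero, ENNReal.ofReal_one, mul_one, ← ENNReal.ofReal_add (by linarith) (by linarith)]
  norm_num

lemma isProbabilityMeasure_heavy {ρ : ℝ} (h1 : 1 ≤ ρ) (h2 : ρ ≤ 2) :
    IsProbabilityMeasure (heavy ρ) := by
  have := isProbabilityMeasure_heavyHalf h1 h2
  constructor
  rw [heavy, Measure.smul_apply, Measure.add_apply,
    Measure.map_apply measurable_neg MeasurableSet.univ, Set.preimage_univ, measure_univ,
    smul_eq_mul, one_add_one_eq_two]
  exact ENNReal.inv_mul_cancel (by norm_num) (by norm_num)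

lemma integral_exp_heavy {ρ : ℝ} (h1 : 1 ≤ ρ) (h2 : ρ ≤ 2) (t : ℝ) :
    ∫ x, Complex.exp ((t * x : ℝ) * Complex.I) ∂heavy ρ = (heavyCos ρ t : ℂ) := by
  have := isProbabilityMeasure_heavyHalf h1 h2
  have hi : ∀ s : ℝ, Integrable (fun x : ℝ => Complex.exp ((s * x : ℝ) * Complex.I))
      (heavyHalf ρ) := fun s =>
    Integrable.of_bound (by fun_prop) 1 (by
      filter_upwards with x
      rw [Complex.norm_exp_ofReal_mul_I])
  have hn : Integrable (fun x : ℝ => Complex.exp ((t * x : ℝ) * Complex.I))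
      ((heavyHalf ρ).map Neg.neg) := by
    rw [integrable_map_measure (by fun_prop) (by fun_prop)]
    refine (hi (-t)).congr ?_
    filter_upwards with x
    simp
  rw [heavy, integral_smul_measure, integral_add_measure (hi t) hn,
    integral_map (by fun_prop) (by fun_prop), ← integral_add (hi t), heavyCos,
    ← integral_complex_ofReal, ← integral_smul]
  · congr 1
    ext x
    simp only [Complex.ofReal_cos, Complex.cos]
    simp
    ring
  · refine (hi (-t)).congr ?_
    filter_upwards with x
    simp

lemma heavyCos_neg (ρ t : ℝ) : heavyCos ρ (-t) = heavyCos ρ t := by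
  simp [heavyCos]

lemma heavyCos_abs (ρ t : ℝ) : heavyCos ρ |t| = heavyCos ρ t := by
  rcases abs_choice t with h | h <;> rw [h]
  exact heavyCos_neg ρ t

lemma abs_heavyCos_le_one {ρ : ℝ} (h1 : 1 ≤ ρ) (h2 : ρ ≤ 2) (t : ℝ) : |heavyCos ρ t| ≤ 1 := by
  have := isProbabilityMeasure_heavyHalf h1 h2
  have h := norm_integral_le_of_norm_le_const (μ := heavyHalf ρ) (f := fun x => Real.cos (t * x))
    (C := 1) (by filter_upwards with x; exact Real.abs_cos_le_one _)
  simpa [heavyCos] using h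

lemma one_sub_heavyCos {ρ : ℝ} (h1 : 1 ≤ ρ) (h2 : ρ ≤ 2) (t : ℝ) :
    1 - heavyCos ρ t = (2 - ρ) * (∫ u in (0 : ℝ)..1, (1 - Real.cos (t * u ^ (-ρ⁻¹)))) +
      (ρ - 1) * (1 - Real.cos t) := by
  have hb : ∀ u : ℝ, ‖Real.cos (t * u ^ (-ρ⁻¹))‖ ≤ 1 := fun u => Real.abs_cos_le_one _
  have hI : Integrable (fun u : ℝ => Real.cos (t * u ^ (-ρ⁻¹)))
      (volume.restrict (Set.Ioc (0 : ℝ) 1)) :=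
    Integrable.of_bound (by fun_prop) 1 (by filter_upwards with u using hb u)
  have hm : Integrable (fun x : ℝ => Real.cos (t * x))
      ((volume.restrict (Set.Ioc (0 : ℝ) 1)).map (fun u => u ^ (-ρ⁻¹))) := by
    rw [integrable_map_measure (by fun_prop) (by fun_prop)]
    exact hI
  rw [heavyCos, heavyHalf, integral_add_measure (hm.smul_measure (by simp))
    ((integrable_dirac (by simp)).smul_measure (by simp)),
    integral_smul_measure, integral_smul_measure, integral_dirac,
    integral_map (by fun_prop) (by fun_prop), intervalIntegral.integral_of_le zero_le_one,
    integral_sub (integrable_const _) hI, ENNReal.toReal_ofReal (by linarith),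
    ENNReal.toReal_ofReal (by linarith)]
  simp
  ring

/-- For `x = u ^ (-1/ρ)`, the integral runs over the event `x ≤ 1 / t`: this is the truncated second
moment of the Pareto law, scaled by `t ^ 2`. The factor `2 - ρ` is the weight of this law in
`heavyHalf ρ`, and compensates for the explosion of the moment as `ρ → 2`. -/
lemma truncated_second_moment {ρ t : ℝ} (h1 : 1 ≤ ρ) (h2 : ρ ≤ 2) (h0 : 0 < t) (ht : t ≤ 1) :
    (2 - ρ) * ∫ u in (t ^ ρ)..1, (t * u ^ (-ρ⁻¹)) ^ 2 = ρ * (t ^ ρ - t ^ 2) := by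
  have ha : 0 < t ^ ρ := Real.rpow_pos_of_pos h0 _
  have ha1 : t ^ ρ ≤ 1 := Real.rpow_le_one h0.le ht (by linarith)
  rcases h2.eq_or_lt with rfl | h2
  · simp
  have hcongr : ∫ u in (t ^ ρ)..1, (t * u ^ (-ρ⁻¹)) ^ 2 =
      ∫ u in (t ^ ρ)..1, t ^ 2 * u ^ (-(2 / ρ)) := by
    refine intervalIntegral.integral_congr fun u hu => ?_
    rw [Set.uIcc_of_le ha1] at hu
    have hu0 : 0 ≤ u := ha.le.trans hu.1
    rw [mul_pow, ← Real.rpow_natCast (u ^ _), ← Real.rpow_mul hu0]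
    congr 2
    push_cast
    ring
  have hρ : ρ - 2 ≠ 0 := by linarith
  have hρ0 : ρ ≠ 0 := by linarith
  have hne : -(2 / ρ) + 1 ≠ 0 := by
    intro h
    apply hρ
    field_simp at h
    linarith
  rw [hcongr, intervalIntegral.integral_const_mul, integral_rpow, Real.one_rpow,
    ← Real.rpow_mul h0.le]
  · have e : ρ * (-(2 / ρ) + 1) = ρ - 2 := by field_simp; ring
    have e2 : t ^ 2 * t ^ (ρ - 2) = t ^ ρ := by
      rw [← Real.rpow_natCast t 2, ← Real.rpow_add h0]
      congr 1
      push_cast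
      ring
    have e3 : -(2 / ρ) + 1 = (ρ - 2) / ρ := by field_simp; ring
    rw [e, ← e2, e3]
    field_simp
    ring
  · right
    refine ⟨fun h => hne (by linarith), ?_⟩
    rw [Set.uIcc_of_le ha1]
    intro h
    exact absurd h.1 (not_le.2 ha)

lemma intervalIntegrable_one_sub_cos_rpow (ρ t a b : ℝ) :
    IntervalIntegrable (fun u : ℝ => 1 - Real.cos (t * u ^ (-ρ⁻¹))) volume a b := by
  have : IsFiniteMeasure (volume.restrict (Set.uIoc a b)) := ⟨by simp [Set.uIoc]⟩
  rw [intervalIntegrable_iff]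
  refine Integrable.of_bound (C := 2) (by fun_prop) ?_
  filter_upwards with u
  have := Real.neg_one_le_cos (t * u ^ (-ρ⁻¹))
  have := Real.cos_le_one (t * u ^ (-ρ⁻¹))
  rw [Real.norm_eq_abs, abs_le]
  constructor <;> linarith

lemma one_sub_heavyCos_le {ρ t : ℝ} (h1 : 1 ≤ ρ) (h2 : ρ ≤ 2) (h0 : 0 ≤ t) :
    1 - heavyCos ρ t ≤ 4 * t ^ ρ := by
  rcases h0.eq_or_lt with rfl | h0
  · have := isProbabilityMeasure_heavyHalf h1 h2
    simp [heavyCos, Real.zero_rpow (show ρ ≠ 0 by linarith)]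
  rcases le_or_gt 1 t with ht | ht
  · have := Real.one_le_rpow ht (show 0 ≤ ρ by linarith)
    have := abs_le.1 (abs_heavyCos_le_one h1 h2 t)
    linarith
  have ha : 0 < t ^ ρ := Real.rpow_pos_of_pos h0 _
  have ha1 : t ^ ρ ≤ 1 := Real.rpow_le_one h0.le ht.le (by linarith)
  have hint := intervalIntegrable_one_sub_cos_rpow ρ t
  have hA : ∫ u in (0 : ℝ)..(t ^ ρ), (1 - Real.cos (t * u ^ (-ρ⁻¹))) ≤
      ∫ u in (0 : ℝ)..(t ^ ρ), (2 : ℝ) := by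
    refine intervalIntegral.integral_mono_on ha.le (hint _ _) (by simp) fun u _ => ?_
    linarith [Real.neg_one_le_cos (t * u ^ (-ρ⁻¹))]
  have hB : ∫ u in (t ^ ρ)..1, (1 - Real.cos (t * u ^ (-ρ⁻¹))) ≤
      ∫ u in (t ^ ρ)..1, (t * u ^ (-ρ⁻¹)) ^ 2 := by
    refine intervalIntegral.integral_mono_on ha1 (hint _ _) ?_ fun u _ => ?_
    · apply ContinuousOn.intervalIntegrable
      rw [Set.uIcc_of_le ha1]
      intro u hu
      have : u ≠ 0 := (ha.trans_le hu.1).ne'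
      exact (((continuousAt_id.rpow_const (Or.inl this)).const_mul t).pow 2).continuousWithinAt
    · nlinarith [Real.one_sub_sq_div_two_le_cos (x := t * u ^ (-ρ⁻¹)), sq_nonneg (t * u ^ (-ρ⁻¹))]
  have hsplit := intervalIntegral.integral_add_adjacent_intervals (hint 0 (t ^ ρ)) (hint (t ^ ρ) 1)
  have htr := truncated_second_moment h1 h2 h0 ht.le
  have hcos : 1 - Real.cos t ≤ t ^ 2 / 2 := by linarith [Real.one_sub_sq_div_two_le_cos (x := t)]
  rw [one_sub_heavyCos h1 h2, ← hsplit]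
  simp only [intervalIntegral.integral_const, sub_zero, smul_eq_mul] at hA
  have e1 := mul_le_mul_of_nonneg_left hA (show 0 ≤ 2 - ρ by linarith)
  have e2 := mul_le_mul_of_nonneg_left hB (show 0 ≤ 2 - ρ by linarith)
  have e3 := mul_le_mul_of_nonneg_left hcos (show 0 ≤ ρ - 1 by linarith)
  nlinarith [mul_nonneg (show 0 ≤ ρ - 1 by linarith) ha.le, sq_nonneg t,
    mul_nonneg (show 0 ≤ 2 - ρ by linarith) (sq_nonneg t)]

lemma le_one_sub_heavyCos {ρ t : ℝ} (h1 : 1 ≤ ρ) (h2 : ρ ≤ 2) (h0 : 0 ≤ t) (ht : t ≤ 1 / 2) :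
    t ^ ρ / 10 ≤ 1 - heavyCos ρ t := by
  rcases h0.eq_or_lt with rfl | h0
  · have := isProbabilityMeasure_heavyHalf h1 h2
    simp [heavyCos, Real.zero_rpow (show ρ ≠ 0 by linarith)]
  have ha : 0 < t ^ ρ := Real.rpow_pos_of_pos h0 _
  have ha1 : t ^ ρ ≤ 1 := Real.rpow_le_one h0.le (by linarith) (by linarith)
  have hint := intervalIntegrable_one_sub_cos_rpow ρ t
  have hA : 0 ≤ ∫ u in (0 : ℝ)..(t ^ ρ), (1 - Real.cos (t * u ^ (-ρ⁻¹))) :=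
    intervalIntegral.integral_nonneg ha.le fun u _ => by
      linarith [Real.cos_le_one (t * u ^ (-ρ⁻¹))]
  have hB : ∫ u in (t ^ ρ)..1, (t * u ^ (-ρ⁻¹)) ^ 2 / 5 ≤
      ∫ u in (t ^ ρ)..1, (1 - Real.cos (t * u ^ (-ρ⁻¹))) := by
    refine intervalIntegral.integral_mono_on ha1 ?_ (hint _ _) fun u hu => ?_
    · apply ContinuousOn.intervalIntegrable
      rw [Set.uIcc_of_le ha1]
      intro u hu
      have : u ≠ 0 := (ha.trans_le hu.1).ne'
      exact ((((continuousAt_id.rpow_const (Or.inl this)).const_mul t).pow 2).div_const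
        5).continuousWithinAt
    · have hu0 : 0 < u := ha.trans_le hu.1
      refine one_sub_cos_ge ?_
      rw [abs_of_nonneg (by positivity)]
      have h3 : u ^ (-ρ⁻¹) ≤ (t ^ ρ) ^ (-ρ⁻¹) :=
        Real.rpow_le_rpow_of_nonpos ha hu.1 (by
          have : 0 < ρ⁻¹ := by positivity
          linarith)
      rw [← Real.rpow_mul h0.le, mul_neg, mul_inv_cancel₀ (by linarith), Real.rpow_neg_one] at h3
      calc t * u ^ (-ρ⁻¹) ≤ t * t⁻¹ := by gcongr
        _ = 1 := mul_inv_cancel₀ h0.ne'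
  have hsplit := intervalIntegral.integral_add_adjacent_intervals (hint 0 (t ^ ρ)) (hint (t ^ ρ) 1)
  have htr := truncated_second_moment h1 h2 h0 (by linarith)
  rw [intervalIntegral.integral_div] at hB
  -- `t ^ 2 ≤ (ρ / 2) * t ^ ρ`, as `t ≤ 1 / 2`
  have hsq : t ^ 2 ≤ ρ / 2 * t ^ ρ := by
    have e : t ^ 2 = t ^ (2 - ρ) * t ^ ρ := by
      rw [← Real.rpow_natCast t 2, ← Real.rpow_add h0]
      congr 1
      push_cast
      ring
    rw [e]
    gcongr
    calc t ^ (2 - ρ) ≤ (1 + -(1 / 2)) ^ (2 - ρ) :=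
          Real.rpow_le_rpow h0.le (by linarith) (by linarith)
      _ ≤ 1 + (2 - ρ) * -(1 / 2) :=
          rpow_one_add_le_one_add_mul_self (by norm_num) (by linarith) (by linarith)
      _ = ρ / 2 := by ring
  have hc := one_sub_cos_ge (x := t) (by rw [abs_of_pos h0]; linarith)
  rw [one_sub_heavyCos h1 h2, ← hsplit]
  have e1 := mul_le_mul_of_nonneg_left hB (show 0 ≤ 2 - ρ by linarith)
  have e2 := mul_nonneg (show 0 ≤ 2 - ρ by linarith) hA
  have e3 := mul_le_mul_of_nonneg_left hc (show 0 ≤ ρ - 1 by linarith)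
  nlinarith [mul_nonneg (show 0 ≤ ρ - 1 by linarith) ha.le]

/-! ### Embedding of `ℓ_ρ` into `L_1` -/

/-- Upper half of the comparison of `∫ G(t) / t ^ 2` with `u / (ρ - 1)`: the range is split at
`t = 1 / u`. -/
lemma lintegral_div_sq_le {G : ℝ → ℝ} {ρ u : ℝ} (h1 : 1 < ρ) (h2 : ρ ≤ 2) (hu : 0 < u)
    (hG2 : ∀ t, G t ≤ 2) (hG : ∀ t, 0 < t → G t ≤ 4 * (t * u) ^ ρ) :
    ∫⁻ t in Set.Ioi (0 : ℝ), ENNReal.ofReal (G t / t ^ 2) ≤ ENNReal.ofReal (6 * u / (ρ - 1)) := by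
  have hu' : 0 < u⁻¹ := inv_pos.2 hu
  have hρ : 0 < ρ - 1 := by linarith
  rw [← Set.Ioc_union_Ioi_eq_Ioi hu'.le,
    lintegral_union measurableSet_Ioi Set.Ioc_disjoint_Ioi_same]
  have hA : ∫⁻ t in Set.Ioc 0 u⁻¹, ENNReal.ofReal (G t / t ^ 2) ≤
      ENNReal.ofReal (4 * u / (ρ - 1)) := by
    have hint : IntegrableOn (fun t : ℝ => 4 * u ^ ρ * t ^ (ρ - 2)) (Set.Ioc 0 u⁻¹) := by
      rw [← intervalIntegrable_iff_integrableOn_Ioc_of_le hu'.le]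
      exact (intervalIntegral.intervalIntegrable_rpow' (by linarith)).const_mul _
    calc ∫⁻ t in Set.Ioc 0 u⁻¹, ENNReal.ofReal (G t / t ^ 2)
        ≤ ∫⁻ t in Set.Ioc 0 u⁻¹, ENNReal.ofReal (4 * u ^ ρ * t ^ (ρ - 2)) := by
          refine setLIntegral_mono' measurableSet_Ioc fun t ht => ENNReal.ofReal_le_ofReal ?_
          have ht0 : 0 < t := ht.1
          rw [div_le_iff₀ (by positivity)]
          refine (hG t ht0).trans_eq ?_
          rw [Real.mul_rpow ht0.le hu.le, mul_assoc, mul_assoc, ← Real.rpow_natCast t 2,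
            ← Real.rpow_add ht0]
          norm_num
          ring
      _ = ENNReal.ofReal (4 * u / (ρ - 1)) := by
          rw [← ofReal_integral_eq_lintegral_ofReal hint, ← intervalIntegral.integral_of_le hu'.le,
            intervalIntegral.integral_const_mul, integral_rpow (Or.inl (by linarith))]
          · congr 1
            rw [Real.zero_rpow (by linarith), Real.inv_rpow hu.le,
              show ρ - 2 + 1 = ρ - 1 by ring, Real.rpow_sub hu, Real.rpow_one]
            have : 0 < u ^ ρ := by positivity
            field_simp
            ring
          · filter_upwards [ae_restrict_mem measurableSet_Ioc] with t ht
            have : 0 < t := ht.1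
            dsimp
            positivity
  have hB : ∫⁻ t in Set.Ioi u⁻¹, ENNReal.ofReal (G t / t ^ 2) ≤
      ENNReal.ofReal (2 * u / (ρ - 1)) := by
    calc ∫⁻ t in Set.Ioi u⁻¹, ENNReal.ofReal (G t / t ^ 2)
        ≤ ∫⁻ t in Set.Ioi u⁻¹, ENNReal.ofReal (2 * t ^ (-2 : ℝ)) := by
          refine setLIntegral_mono' measurableSet_Ioi fun t ht => ENNReal.ofReal_le_ofReal ?_
          have ht0 : 0 < t := hu'.trans ht
          rw [Real.rpow_neg ht0.le, ← div_eq_mul_inv]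
          norm_num
          gcongr
          exact hG2 t
      _ = ENNReal.ofReal (2 * u) := by
          rw [← ofReal_integral_eq_lintegral_ofReal
            ((integrableOn_Ioi_rpow_of_lt (by norm_num) hu').const_mul 2),
            integral_const_mul, integral_Ioi_rpow_of_lt (by norm_num) hu']
          · congr 1
            norm_num
            rw [Real.rpow_neg_one, inv_inv]
          · filter_upwards [ae_restrict_mem measurableSet_Ioi] with t ht
            have : 0 < t := hu'.trans ht
            dsimp
            positivity
      _ ≤ ENNReal.ofReal (2 * u / (ρ - 1)) := by
          refine ENNReal.ofReal_le_ofReal ?_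
          rw [le_div_iff₀ hρ]
          nlinarith
  refine (add_le_add hA hB).trans_eq ?_
  rw [← ENNReal.ofReal_add (by positivity) (by positivity)]
  congr 1
  ring

/-- Lower half of the comparison of `∫ G(t) / t ^ 2` with `u / (ρ - 1)`. As `ρ ≤ 2`, already the
range `t ≤ 1 / (4 u)` contributes this order of magnitude. -/
lemma le_lintegral_div_sq {G : ℝ → ℝ} {ρ u : ℝ} (h1 : 1 < ρ) (h2 : ρ ≤ 2) (hu : 0 < u)
    (hG : ∀ t, 0 < t → t * u ≤ 1 / 4 → (t * u) ^ ρ / 20 ≤ G t) :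
    ENNReal.ofReal (u / (80 * (ρ - 1))) ≤
      ∫⁻ t in Set.Ioi (0 : ℝ), ENNReal.ofReal (G t / t ^ 2) := by
  have hρ : 0 < ρ - 1 := by linarith
  set b : ℝ := (4 * u)⁻¹ with hb
  have hb0 : 0 < b := by positivity
  have hint : IntegrableOn (fun t : ℝ => u ^ ρ / 20 * t ^ (ρ - 2)) (Set.Ioc 0 b) := by
    rw [← intervalIntegrable_iff_integrableOn_Ioc_of_le hb0.le]
    exact (intervalIntegral.intervalIntegrable_rpow' (by linarith)).const_mul _
  calc ENNReal.ofReal (u / (80 * (ρ - 1)))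
      ≤ ENNReal.ofReal (u ^ ρ / 20 * (b ^ (ρ - 1) / (ρ - 1))) := by
        refine ENNReal.ofReal_le_ofReal ?_
        have h4 : (1 / 4 : ℝ) ≤ (1 / 4 : ℝ) ^ (ρ - 1) := by
          conv_lhs => rw [← Real.rpow_one (1 / 4 : ℝ)]
          exact Real.rpow_le_rpow_of_exponent_ge (by norm_num) (by norm_num) (by linarith)
        have e : u ^ ρ * b ^ (ρ - 1) = u * (1 / 4 : ℝ) ^ (ρ - 1) := by
          rw [hb, mul_inv, Real.mul_rpow (by norm_num) (by positivity), Real.inv_rpow hu.le,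
            Real.rpow_sub hu, Real.rpow_one]
          have : 0 < u ^ ρ := by positivity
          norm_num
          field_simp
        have e' : u ^ ρ / 20 * (b ^ (ρ - 1) / (ρ - 1)) =
            u * (1 / 4 : ℝ) ^ (ρ - 1) / (20 * (ρ - 1)) := by
          rw [← e]; field_simp
        rw [e', div_le_div_iff₀ (by positivity) (by positivity)]
        nlinarith [mul_pos hu hρ]
    _ = ∫⁻ t in Set.Ioc 0 b, ENNReal.ofReal (u ^ ρ / 20 * t ^ (ρ - 2)) := by
        rw [← ofReal_integral_eq_lintegral_ofReal hint, ← intervalIntegral.integral_of_le hb0.le,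
          intervalIntegral.integral_const_mul, integral_rpow (Or.inl (by linarith))]
        · rw [Real.zero_rpow (by linarith), sub_zero, show ρ - 2 + 1 = ρ - 1 by ring]
        · filter_upwards [ae_restrict_mem measurableSet_Ioc] with t ht
          have : 0 < t := ht.1
          dsimp
          positivity
    _ ≤ ∫⁻ t in Set.Ioc 0 b, ENNReal.ofReal (G t / t ^ 2) := by
        refine setLIntegral_mono' measurableSet_Ioc fun t ht => ENNReal.ofReal_le_ofReal ?_
        have ht0 : 0 < t := ht.1
        rw [le_div_iff₀ (by positivity)]
        refine le_trans (le_of_eq ?_) (hG t ht0 ?_)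
        · rw [Real.mul_rpow ht0.le hu.le, mul_assoc, ← Real.rpow_natCast t 2,
            ← Real.rpow_add ht0]
          norm_num
          ring
        · calc t * u ≤ b * u := by gcongr; exact ht.2
            _ = 1 / 4 := by rw [hb]; field_simp
    _ ≤ _ := lintegral_mono_set Set.Ioc_subset_Ioi_self

/-- `∫ (1 - cos t) / t ^ 2` over `(0, ∞)`. -/
noncomputable def cosKernel : ℝ≥0∞ :=
  ∫⁻ t in Set.Ioi (0 : ℝ), ENNReal.ofReal ((1 - Real.cos t) / t ^ 2)

lemma cosKernel_ne_top : cosKernel ≠ ∞ := by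
  refine ne_top_of_le_ne_top ENNReal.ofReal_ne_top
    (lintegral_div_sq_le (G := fun t => 1 - Real.cos t) (ρ := 2) (u := 1) (by norm_num) le_rfl
      one_pos (fun t => ?_) fun t _ => ?_)
  · linarith [Real.neg_one_le_cos t]
  · norm_num
    linarith [Real.one_sub_sq_div_two_le_cos (x := t), sq_nonneg t]

lemma cosKernel_ne_zero : cosKernel ≠ 0 := by
  have h := le_lintegral_div_sq (G := fun t => 1 - Real.cos t) (ρ := 2) (u := 1) (by norm_num)
    le_rfl one_pos fun t ht0 ht => by
      norm_num at ht ⊢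
      have := one_sub_cos_ge (x := t) (by rw [abs_of_pos ht0]; linarith)
      linarith [sq_nonneg t]
  intro h0
  rw [← cosKernel, h0] at h
  norm_num at h

/-- The Fourier representation of the absolute value, up to a constant. -/
lemma lintegral_one_sub_cos_mul (a : ℝ) :
    ∫⁻ t in Set.Ioi (0 : ℝ), ENNReal.ofReal ((1 - Real.cos (t * a)) / t ^ 2) =
      ENNReal.ofReal |a| * cosKernel := by
  rcases eq_or_ne a 0 with rfl | ha
  · simp
  have hb : 0 < |a| := abs_pos.2 ha
  have hm : Measurable fun t : ℝ => ENNReal.ofReal ((1 - Real.cos t) / t ^ 2) := by fun_prop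
  have hsub : ∫⁻ t in Set.Ioi (0 : ℝ),
      ENNReal.ofReal ((1 - Real.cos (|a| * t)) / (|a| * t) ^ 2) =
        ENNReal.ofReal |a|⁻¹ * cosKernel := by
    have h := lintegral_map (μ := volume) (hm.indicator (measurableSet_Ioi (a := (0 : ℝ))))
      (measurable_const_mul |a|)
    rw [Real.map_volume_mul_left hb.ne', lintegral_smul_measure,
      lintegral_indicator measurableSet_Ioi] at h
    rw [cosKernel, ← abs_of_pos (inv_pos.2 hb), ← smul_eq_mul, h,
      ← lintegral_indicator measurableSet_Ioi]
    refine lintegral_congr fun t => ?_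
    by_cases ht : 0 < t
    · rw [Set.indicator_of_mem (show t ∈ Set.Ioi (0:ℝ) from ht),
        Set.indicator_of_mem (show |a| * t ∈ Set.Ioi (0:ℝ) from mul_pos hb ht)]
    · rw [Set.indicator_of_notMem (show t ∉ Set.Ioi (0:ℝ) from ht),
        Set.indicator_of_notMem (show |a| * t ∉ Set.Ioi (0:ℝ) from fun h => ht
          (pos_of_mul_pos_right (Set.mem_Ioi.1 h) hb.le))]
  have e : ∀ t : ℝ, ENNReal.ofReal ((1 - Real.cos (t * a)) / t ^ 2) =
      ENNReal.ofReal (|a| ^ 2) * ENNReal.ofReal ((1 - Real.cos (|a| * t)) / (|a| * t) ^ 2) := by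
    intro t
    rw [← ENNReal.ofReal_mul (by positivity)]
    congr 1
    have : Real.cos (|a| * t) = Real.cos (t * a) := by
      rcases abs_choice a with h | h <;> rw [h]
      · rw [mul_comm]
      · rw [neg_mul, Real.cos_neg, mul_comm]
    rw [this, mul_pow]
    rcases eq_or_ne t 0 with rfl | ht
    · simp
    field_simp
  simp_rw [e]
  rw [lintegral_const_mul _ (by fun_prop), hsub, ← mul_assoc, ← ENNReal.ofReal_mul (by positivity)]
  congr 2
  field_simp

lemma one_sub_prod_le_sum {ι : Type*} (s : Finset ι) (f : ι → ℝ) (hf : ∀ i, |f i| ≤ 1) :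
    1 - ∏ i ∈ s, f i ≤ ∑ i ∈ s, (1 - f i) ∧ |∏ i ∈ s, f i| ≤ 1 := by
  classical
  induction s using Finset.induction_on with
  | empty => simp
  | insert i s hi ih =>
    rw [Finset.prod_insert hi, Finset.sum_insert hi]
    obtain ⟨h1, h2⟩ := ih
    have h3 := abs_le.1 (hf i)
    have h4 := abs_le.1 h2
    refine ⟨by nlinarith, ?_⟩
    rw [abs_mul]
    exact mul_le_one₀ (hf i) (abs_nonneg _) h2

section FiniteIndex

variable {ι : Type*} [Fintype ι]

/-- The characteristic function of `∑ i, ω i * z i`, for independent `ω i` with law `heavy ρ`. -/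
lemma integral_cos_pi_heavy {ρ : ℝ} (h1 : 1 ≤ ρ) (h2 : ρ ≤ 2) (z : ι → ℝ) (t : ℝ) :
    ∫ ω, Real.cos (t * ∑ i, ω i * z i) ∂(Measure.pi fun _ : ι => heavy ρ) =
      ∏ i, heavyCos ρ (t * z i) := by
  have := isProbabilityMeasure_heavy h1 h2
  have h := integral_fintype_prod_eq_prod (𝕜 := ℂ) (μ := fun _ : ι => heavy ρ)
    (fun (i : ι) (x : ℝ) => Complex.exp ((t * z i * x : ℝ) * Complex.I))
  simp_rw [integral_exp_heavy h1 h2, ← Complex.exp_sum] at h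
  have h' := congrArg Complex.re h
  rw [← Complex.ofReal_prod, Complex.ofReal_re, ← RCLike.re_eq_complex_re, ← integral_re] at h'
  · rw [← h']
    refine integral_congr_ae ?_
    filter_upwards with ω
    rw [← Finset.sum_mul, ← Complex.ofReal_sum, RCLike.re_eq_complex_re,
      Complex.exp_ofReal_mul_I_re, Finset.mul_sum]
    congr 1
    exact Finset.sum_congr rfl fun i _ => by ring
  · refine Integrable.of_bound (Measurable.aestronglyMeasurable (by fun_prop)) 1 ?_
    filter_upwards with ω
    rw [← Finset.sum_mul, ← Complex.ofReal_sum, Complex.norm_exp_ofReal_mul_I]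

lemma lintegral_abs_pi_heavy {ρ : ℝ} (h1 : 1 ≤ ρ) (h2 : ρ ≤ 2) (z : ι → ℝ) :
    (∫⁻ ω, ENNReal.ofReal |∑ i, ω i * z i| ∂(Measure.pi fun _ : ι => heavy ρ)) * cosKernel =
      ∫⁻ t in Set.Ioi (0 : ℝ), ENNReal.ofReal ((1 - ∏ i, heavyCos ρ (t * z i)) / t ^ 2) := by
  have := isProbabilityMeasure_heavy h1 h2
  rw [← lintegral_mul_const _ (by fun_prop)]
  simp_rw [← lintegral_one_sub_cos_mul]
  rw [lintegral_lintegral_swap (by fun_prop)]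
  refine lintegral_congr fun t => ?_
  have hi : Integrable (fun ω : ι → ℝ => Real.cos (t * ∑ i, ω i * z i))
      (Measure.pi fun _ : ι => heavy ρ) :=
    Integrable.of_bound (Measurable.aestronglyMeasurable (by fun_prop)) 1
      (by filter_upwards with ω using Real.abs_cos_le_one _)
  rw [← ofReal_integral_eq_lintegral_ofReal
    (f := fun ω : ι → ℝ => (1 - Real.cos (t * ∑ i, ω i * z i)) / t ^ 2)
    (((integrable_const _).sub hi).div_const _)]
  · rw [integral_div, integral_sub (integrable_const _) hi, integral_cos_pi_heavy h1 h2]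
    simp
  · filter_upwards with ω
    exact div_nonneg (by linarith [Real.cos_le_one (t * ∑ i, ω i * z i)]) (sq_nonneg t)

/-- The `ℓ_ρ` norm of a vector, as a formula. -/
noncomputable def lpNorm (ρ : ℝ) (z : ι → ℝ) : ℝ := (∑ i, |z i| ^ ρ) ^ (1 / ρ)

lemma lpNorm_nonneg (ρ : ℝ) (z : ι → ℝ) : 0 ≤ lpNorm ρ z := by
  unfold lpNorm; positivity

lemma lpNorm_rpow {ρ : ℝ} (h1 : 1 ≤ ρ) (z : ι → ℝ) : lpNorm ρ z ^ ρ = ∑ i, |z i| ^ ρ := by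
  rw [lpNorm, ← Real.rpow_mul (by positivity), one_div, inv_mul_cancel₀ (by linarith),
    Real.rpow_one]

lemma abs_le_lpNorm {ρ : ℝ} (h1 : 1 ≤ ρ) (z : ι → ℝ) (i : ι) : |z i| ≤ lpNorm ρ z := by
  rw [← Real.rpow_le_rpow_iff (abs_nonneg _) (lpNorm_nonneg _ _) (show 0 < ρ by linarith),
    lpNorm_rpow h1]
  exact Finset.single_le_sum (f := fun i => |z i| ^ ρ) (fun i _ => by positivity)
    (Finset.mem_univ i)

/-- For independent `ω i` with law `heavy ρ`, the mean of `|∑ i, ω i * z i|` is comparable to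
`‖z‖_ρ / (ρ - 1)`, with universal constants. It is infinite for `ρ = 1`. -/
lemma lintegral_abs_pi_heavy_bounds {ρ : ℝ} (h1 : 1 < ρ) (h2 : ρ ≤ 2) (z : ι → ℝ) :
    ENNReal.ofReal (lpNorm ρ z / (80 * (ρ - 1))) ≤
      (∫⁻ ω, ENNReal.ofReal |∑ i, ω i * z i| ∂(Measure.pi fun _ : ι => heavy ρ)) * cosKernel ∧
    (∫⁻ ω, ENNReal.ofReal |∑ i, ω i * z i| ∂(Measure.pi fun _ : ι => heavy ρ)) * cosKernel ≤
      ENNReal.ofReal (6 * lpNorm ρ z / (ρ - 1)) := by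
  rcases (lpNorm_nonneg ρ z).eq_or_lt with h0 | hu
  · have hz : ∀ i, z i = 0 := fun i => by
      have := abs_le_lpNorm h1.le z i
      rw [← h0] at this
      exact abs_nonpos_iff.1 this
    simp [← h0, hz]
  rw [lintegral_abs_pi_heavy h1.le h2]
  set u := lpNorm ρ z with hudef
  have hsum : ∀ t : ℝ, 0 < t → ∑ i, |t * z i| ^ ρ = (t * u) ^ ρ := by
    intro t ht
    rw [Real.mul_rpow ht.le hu.le, hudef, lpNorm_rpow h1.le, Finset.mul_sum]
    refine Finset.sum_congr rfl fun i _ => ?_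
    rw [abs_mul, abs_of_pos ht, Real.mul_rpow ht.le (abs_nonneg _)]
  constructor
  · refine le_lintegral_div_sq h1 h2 hu fun t ht htu => ?_
    have hti : ∀ i, |t * z i| ≤ 1 / 4 := fun i => by
      rw [abs_mul, abs_of_pos ht]
      exact (mul_le_mul_of_nonneg_left (abs_le_lpNorm h1.le z i) ht.le).trans htu
    have hφ0 : ∀ i, 0 ≤ heavyCos ρ (t * z i) := fun i => by
      have h := one_sub_heavyCos_le h1.le h2 (abs_nonneg (t * z i))
      rw [heavyCos_abs] at h
      have h' : |t * z i| ^ ρ ≤ |t * z i| := by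
        conv_rhs => rw [← Real.rpow_one |t * z i|]
        exact Real.rpow_le_rpow_of_exponent_ge' (abs_nonneg _) (by linarith [hti i]) zero_le_one
          h1.le
      linarith [hti i]
    have hprod : ∏ i, heavyCos ρ (t * z i) ≤ Real.exp (-((t * u) ^ ρ / 10)) := by
      calc ∏ i, heavyCos ρ (t * z i) ≤ ∏ i, Real.exp (-(|t * z i| ^ ρ / 10)) := by
            refine Finset.prod_le_prod (fun i _ => hφ0 i) fun i _ => ?_
            have h := le_one_sub_heavyCos h1.le h2 (abs_nonneg (t * z i)) (by linarith [hti i])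
            rw [heavyCos_abs] at h
            linarith [Real.add_one_le_exp (-(|t * z i| ^ ρ / 10))]
        _ = Real.exp (-((t * u) ^ ρ / 10)) := by
            rw [← Real.exp_sum, Finset.sum_neg_distrib, ← Finset.sum_div, hsum t ht]
    have hx0 : 0 ≤ (t * u) ^ ρ := by positivity
    have hx1 : (t * u) ^ ρ ≤ 1 := Real.rpow_le_one (by positivity) (by linarith) (by linarith)
    -- `exp (-x) ≤ 1 - x / 2` on `[0, 1]`
    have hexp : Real.exp (-((t * u) ^ ρ / 10)) ≤ 1 - (t * u) ^ ρ / 20 := by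
      set x := (t * u) ^ ρ / 10 with hx
      have hx' : x ≤ 1 := by linarith
      have hp : 0 < 1 + x := by linarith
      have h := Real.add_one_le_exp x
      rw [Real.exp_neg]
      calc (Real.exp x)⁻¹ ≤ (1 + x)⁻¹ := by gcongr; linarith
        _ ≤ 1 - x / 2 := by
          rw [inv_le_iff_one_le_mul₀ hp]
          nlinarith
        _ = _ := by rw [hx]; ring
    linarith
  · refine lintegral_div_sq_le h1 h2 hu (fun t => ?_) fun t ht => ?_
    · have := abs_le.1 (one_sub_prod_le_sum Finset.univ (fun i => heavyCos ρ (t * z i))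
        fun i => abs_heavyCos_le_one h1.le h2 _).2
      linarith
    · refine (one_sub_prod_le_sum Finset.univ (fun i => heavyCos ρ (t * z i))
        fun i => abs_heavyCos_le_one h1.le h2 _).1.trans ?_
      rw [← hsum t ht, Finset.mul_sum]
      refine Finset.sum_le_sum fun i _ => ?_
      rw [← heavyCos_abs]
      exact one_sub_heavyCos_le h1.le h2 (abs_nonneg _)

end FiniteIndex

/-- For every `ρ ∈ [1, 2]` there is a random linear functional on `ℝ ^ d` whose mean absolute value
is the `ℓ_ρ` norm up to a normalization `a` and a factor in `[1, 480]`: `ℓ_ρ` embeds into `L_1` with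
universal distortion. -/
theorem exists_random_functional {ρ : ℝ} (h1 : 1 ≤ ρ) (h2 : ρ ≤ 2) (d : ℕ) :
    ∃ μ : Measure (Fin d → ℝ), IsProbabilityMeasure μ ∧ (∀ i, Integrable (fun ω => ω i) μ) ∧
      ∃ a : ℝ, 0 < a ∧ ∀ z : Fin d → ℝ, a * lpNorm ρ z ≤ ∫ ω, |∑ i, ω i * z i| ∂μ ∧
        ∫ ω, |∑ i, ω i * z i| ∂μ ≤ 480 * a * lpNorm ρ z := by
  rcases h1.eq_or_lt with rfl | h1
  · rcases Nat.eq_zero_or_pos d with rfl | hd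
    · exact ⟨Measure.dirac 0, inferInstance, fun i => i.elim0, 1, one_pos, fun z => by
        simp [lpNorm]⟩
    -- for `ρ = 1`, a uniformly random coordinate
    have hd' : (d : ℝ≥0∞) ≠ 0 := by exact_mod_cast hd.ne'
    have hd'' : (0 : ℝ) < d := by exact_mod_cast hd
    have hint : ∀ f : (Fin d → ℝ) → ℝ, ∀ j : Fin d,
        Integrable f ((d : ℝ≥0∞)⁻¹ • Measure.dirac (Pi.single j (1 : ℝ))) := fun f j =>
      (integrable_dirac (by simp)).smul_measure (by simp [hd'])
    refine ⟨∑ j : Fin d, (d : ℝ≥0∞)⁻¹ • Measure.dirac (Pi.single j (1 : ℝ)), ⟨?_⟩, ?_, (d : ℝ)⁻¹,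
      by positivity, fun z => ?_⟩
    · simp only [Measure.coe_finsetSum, Finset.sum_apply, Measure.smul_apply, measure_univ,
        smul_eq_mul, mul_one, Finset.sum_const, Finset.card_univ, Fintype.card_fin, nsmul_eq_mul]
      exact ENNReal.mul_inv_cancel hd' (by simp)
    · exact fun i => integrable_finsetSum_measure.2 fun j _ => hint _ j
    · have e : ∫ ω, |∑ i, ω i * z i| ∂(∑ j : Fin d, (d : ℝ≥0∞)⁻¹ •
          Measure.dirac (Pi.single j (1 : ℝ))) = (d : ℝ)⁻¹ * lpNorm 1 z := by
        rw [integral_finsetSum_measure fun j _ => hint _ j]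
        simp [integral_smul_measure, integral_dirac, Pi.single_apply, lpNorm, Finset.mul_sum]
      have : 0 ≤ (d : ℝ)⁻¹ * lpNorm 1 z := mul_nonneg (by positivity) (lpNorm_nonneg _ _)
      rw [e]
      constructor <;> linarith
  · have := isProbabilityMeasure_heavy h1.le h2
    have hρ : 0 < ρ - 1 := by linarith
    have hk : 0 < cosKernel.toReal := ENNReal.toReal_pos cosKernel_ne_zero cosKernel_ne_top
    set μ := Measure.pi fun _ : Fin d => heavy ρ with hμ
    have hfin : ∀ z : Fin d → ℝ, ∫⁻ ω, ENNReal.ofReal |∑ i, ω i * z i| ∂μ ≠ ∞ := by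
      intro z h
      have h' := (lintegral_abs_pi_heavy_bounds h1 h2 z).2
      rw [← hμ, h, ENNReal.top_mul cosKernel_ne_zero] at h'
      exact ENNReal.ofReal_ne_top (top_le_iff.1 h')
    have hreal : ∀ z : Fin d → ℝ, ∫ ω, |∑ i, ω i * z i| ∂μ =
        (∫⁻ ω, ENNReal.ofReal |∑ i, ω i * z i| ∂μ).toReal := fun z =>
      integral_eq_lintegral_of_nonneg_ae (by filter_upwards with ω using abs_nonneg _)
        (Measurable.aestronglyMeasurable (by fun_prop))
    refine ⟨μ, inferInstance, fun i => ?_, (80 * (ρ - 1) * cosKernel.toReal)⁻¹, by positivity,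
      fun z => ?_⟩
    · refine ⟨(measurable_pi_apply i).aestronglyMeasurable, ?_⟩
      have h := hfin (Pi.single i 1)
      simp only [Pi.single_apply, mul_ite, mul_one, mul_zero, Finset.sum_ite_eq',
        Finset.mem_univ, if_true] at h
      rw [hasFiniteIntegral_iff_norm]
      simpa [Real.norm_eq_abs] using lt_top_iff_ne_top.2 h
    · obtain ⟨hl, hr⟩ := lintegral_abs_pi_heavy_bounds h1 h2 z
      rw [← hμ] at hl hr
      have hl' := ENNReal.toReal_mono (ENNReal.mul_ne_top (hfin z) cosKernel_ne_top) hl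
      have hr' := ENNReal.toReal_mono ENNReal.ofReal_ne_top hr
      have hN := lpNorm_nonneg ρ z
      rw [ENNReal.toReal_mul, ← hreal, ENNReal.toReal_ofReal (by positivity)] at hl' hr'
      constructor
      · rw [inv_mul_le_iff₀ (by positivity)]
        rw [div_le_iff₀ (by positivity)] at hl'
        linarith
      · rw [le_div_iff₀ hρ] at hr'
        rw [mul_comm (480 : ℝ), mul_assoc, le_inv_mul_iff₀ (by positivity)]
        nlinarith

/-! ### The locality sensitive family -/

/-- A random functional still has mean absolute value at least half of the truncated norm when its
absolute value is truncated at a high enough level. -/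
lemma exists_truncation {d : ℕ} {ρ a : ℝ} (h1 : 1 ≤ ρ) (ha : 0 < a) (μ : Measure (Fin d → ℝ))
    [IsProbabilityMeasure μ] (hint : ∀ i, Integrable (fun ω => ω i) μ)
    (hμ : ∀ z : Fin d → ℝ, a * lpNorm ρ z ≤ ∫ ω, |∑ i, ω i * z i| ∂μ) (Δ : ℝ) (hΔ : 0 < Δ) :
    ∃ w : ℝ, 0 < w ∧ ∀ z : Fin d → ℝ,
      a / 2 * min (lpNorm ρ z) Δ ≤ ∫ ω, min |∑ i, ω i * z i| w ∂μ := by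
  set Θ : (Fin d → ℝ) → ℝ := fun ω => ∑ i, |ω i| with hΘ
  have hΘ0 : ∀ ω, 0 ≤ Θ ω := fun ω => Finset.sum_nonneg fun i _ => abs_nonneg _
  have hΘi : Integrable Θ μ := integrable_finsetSum _ fun i _ => (hint i).abs
  have hΘm : Measurable Θ := by fun_prop
  have hmin : ∀ w' : ℝ, 0 ≤ w' → Integrable (fun ω => min (Θ ω) w') μ := fun w' hw' =>
    hΘi.mono' (by fun_prop) (by
      filter_upwards with ω
      rw [Real.norm_eq_abs, abs_of_nonneg (le_min (hΘ0 ω) hw')]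
      exact min_le_left _ _)
  have hlim : Filter.Tendsto (fun n : ℕ => ∫ ω, min (Θ ω) n ∂μ) Filter.atTop
      (nhds (∫ ω, Θ ω ∂μ)) := by
    refine tendsto_integral_of_dominated_convergence Θ
      (fun n => (hmin n (Nat.cast_nonneg n)).aestronglyMeasurable) hΘi (fun n => ?_) ?_
    · filter_upwards with ω
      rw [Real.norm_eq_abs, abs_of_nonneg (le_min (hΘ0 ω) (Nat.cast_nonneg n))]
      exact min_le_left _ _
    · filter_upwards with ω
      refine tendsto_const_nhds.congr' ?_
      filter_upwards [Filter.eventually_ge_atTop ⌈Θ ω⌉₊] with n hn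
      rw [min_eq_left (Nat.ceil_le.1 hn)]
  obtain ⟨n, hn1, hn⟩ := ((Filter.eventually_ge_atTop 1).and (hlim.eventually
    (lt_mem_nhds (show ∫ ω, Θ ω ∂μ - a / 2 < ∫ ω, Θ ω ∂μ by linarith)))).exists
  have hn0 : (0 : ℝ) < n := by exact_mod_cast hn1
  refine ⟨Δ * n, by positivity, fun z => ?_⟩
  rcases (lpNorm_nonneg ρ z).eq_or_lt with h0 | hN
  · rw [← h0, min_eq_left hΔ.le, mul_zero]
    exact integral_nonneg fun ω => le_min (abs_nonneg _) (by positivity)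
  set N := lpNorm ρ z with hNdef
  have hX : ∀ ω : Fin d → ℝ, |∑ i, ω i * z i| ≤ N * Θ ω := fun ω => by
    refine (Finset.abs_sum_le_sum_abs _ _).trans ?_
    rw [hΘ, Finset.mul_sum]
    refine Finset.sum_le_sum fun i _ => ?_
    rw [abs_mul, mul_comm]
    exact mul_le_mul_of_nonneg_right (abs_le_lpNorm h1 z i) (abs_nonneg _)
  have hXi : Integrable (fun ω : Fin d → ℝ => |∑ i, ω i * z i|) μ :=
    (integrable_finsetSum _ fun i _ => (hint i).mul_const _).abs
  have hni : Integrable (fun ω => min (Θ ω) n) μ := hmin n hn0.le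
  set s := min N Δ / N with hs
  have hs0 : 0 < s := div_pos (lt_min hN hΔ) hN
  have hs1 : s ≤ 1 := (div_le_one hN).2 (min_le_left _ _)
  have hsN : s * N ≤ Δ := by
    rw [hs, div_mul_cancel₀ _ hN.ne']
    exact min_le_right _ _
  have hpt : ∀ ω : Fin d → ℝ, s * (|∑ i, ω i * z i| - N * (Θ ω - min (Θ ω) n)) ≤
      min |∑ i, ω i * z i| (Δ * n) := fun ω => by
    have hx0 := abs_nonneg (∑ i, ω i * z i)
    have hr : 0 ≤ N * (Θ ω - min (Θ ω) n) :=
      mul_nonneg hN.le (sub_nonneg.2 (min_le_left _ _))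
    refine le_min ?_ ?_
    · calc s * (|∑ i, ω i * z i| - N * (Θ ω - min (Θ ω) n)) ≤ s * |∑ i, ω i * z i| := by
            gcongr; linarith
        _ ≤ 1 * |∑ i, ω i * z i| := by gcongr
        _ = _ := one_mul _
    · calc s * (|∑ i, ω i * z i| - N * (Θ ω - min (Θ ω) n)) ≤ s * (N * n) := by
            gcongr
            have := mul_le_mul_of_nonneg_left (min_le_right (Θ ω) n) hN.le
            linarith [hX ω]
        _ = s * N * n := by ring
        _ ≤ Δ * n := by gcongr
  have hRi : Integrable (fun ω => N * (Θ ω - min (Θ ω) n)) μ := (hΘi.sub hni).const_mul N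
  have hLi : Integrable (fun ω : Fin d → ℝ =>
      s * (|∑ i, ω i * z i| - N * (Θ ω - min (Θ ω) n))) μ :=
    (hXi.sub hRi).const_mul s
  calc a / 2 * min N Δ = s * (a * N - N * (a / 2)) := by rw [hs]; field_simp; ring
    _ ≤ s * (∫ ω, |∑ i, ω i * z i| ∂μ - N * (∫ ω, Θ ω ∂μ - ∫ ω, min (Θ ω) n ∂μ)) := by
        gcongr
        · exact hμ z
        · linarith
    _ = ∫ ω, s * (|∑ i, ω i * z i| - N * (Θ ω - min (Θ ω) n)) ∂μ := by
        rw [integral_const_mul, integral_sub hXi hRi, integral_const_mul,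
          integral_sub hΘi hni]
    _ ≤ _ := integral_mono hLi (hXi.mono' (Measurable.aestronglyMeasurable (by fun_prop)) (by
        filter_upwards with ω
        rw [Real.norm_eq_abs, abs_of_nonneg (le_min (abs_nonneg _) (by positivity))]
        exact min_le_left _ _)) hpt

lemma integral_floor_add (a : ℝ) : ∫ s in (0 : ℝ)..1, ((⌊a + s⌋ : ℤ) : ℝ) = a := by
  have hfi : ∀ b c : ℝ, IntervalIntegrable (fun s : ℝ => Int.fract s) volume b c := fun b c => by
    have : IsFiniteMeasure (volume.restrict (Set.uIoc b c)) := ⟨by simp [Set.uIoc]⟩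
    rw [intervalIntegrable_iff]
    refine Integrable.of_bound (C := 1) (measurable_fract.aestronglyMeasurable) ?_
    filter_upwards with u
    rw [Real.norm_eq_abs, abs_of_nonneg (Int.fract_nonneg u)]
    exact (Int.fract_lt_one u).le
  have hfr : ∫ s in (0 : ℝ)..1, Int.fract (a + s) = 1 / 2 := by
    rw [intervalIntegral.integral_comp_add_left (fun s => Int.fract s) a, add_zero]
    have hp : Function.Periodic (Int.fract : ℝ → ℝ) 1 := fun x => Int.fract_add_one x
    rw [hp.intervalIntegral_add_eq a 0, zero_add]
    have : ∫ s in (0 : ℝ)..1, Int.fract s = ∫ s in (0 : ℝ)..1, s := by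
      refine intervalIntegral.integral_congr_ae ?_
      have h1 : ∀ᵐ s : ℝ, s ≠ 1 := by simp [ae_iff]
      filter_upwards [h1] with s hs hmem
      rw [Set.uIoc_of_le zero_le_one] at hmem
      exact Int.fract_eq_self.2 ⟨hmem.1.le, lt_of_le_of_ne hmem.2 hs⟩
    rw [this]
    simp
  have hsplit : ∀ s : ℝ, ((⌊a + s⌋ : ℤ) : ℝ) = (a + s) - Int.fract (a + s) := fun s => by
    rw [← Int.self_sub_fract]
  simp_rw [hsplit]
  rw [intervalIntegral.integral_sub (Continuous.intervalIntegrable (by fun_prop) _ _), hfr,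
    intervalIntegral.integral_add (by simp) (by simp)]
  · simp
  · have := (hfi a (a + 1)).comp_add_left (c := a)
    simpa using this

/-- A uniformly random shift of the integer grid separates `a` and `b` with probability
`min |a - b| 1`. -/
lemma measure_floor_ne (a b : ℝ) :
    (volume.restrict (Set.Ioc (0 : ℝ) 1)) {s | ⌊a + s⌋ ≠ ⌊b + s⌋} =
      ENNReal.ofReal (min |a - b| 1) := by
  wlog hab : a ≤ b generalizing a b
  · rw [abs_sub_comm, ← this b a (le_of_not_ge hab)]
    simp only [ne_comm]
  have hP : IsProbabilityMeasure (volume.restrict (Set.Ioc (0 : ℝ) 1)) := ⟨by simp⟩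
  rw [abs_sub_comm, abs_of_nonneg (sub_nonneg.2 hab)]
  rcases le_or_gt 1 (b - a) with h | h
  · have : {s : ℝ | ⌊a + s⌋ ≠ ⌊b + s⌋} = Set.univ := by
      refine Set.eq_univ_of_forall fun s hs => ?_
      have h1 := Int.lt_floor_add_one (a + s)
      have h2 := Int.floor_le (b + s)
      have h3 := Int.floor_le (a + s)
      have h4 := Int.lt_floor_add_one (b + s)
      have hs' : ((⌊a + s⌋ : ℤ) : ℝ) = ⌊b + s⌋ := by exact_mod_cast hs
      linarith
    rw [this, measure_univ, min_eq_right h]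
    simp
  · rw [min_eq_left h.le]
    have hmeas : MeasurableSet {s : ℝ | ⌊a + s⌋ ≠ ⌊b + s⌋} :=
      (measurableSet_eq_fun (by fun_prop) (by fun_prop)).compl
    have hbd : ∀ c : ℝ, IntervalIntegrable (fun s : ℝ => ((⌊c + s⌋ : ℤ) : ℝ)) volume 0 1 := by
      intro c
      refine MonotoneOn.intervalIntegrable fun x _ y _ hxy => ?_
      exact_mod_cast Int.floor_mono (by linarith)
    have hind : ∀ s : ℝ, ((⌊b + s⌋ : ℤ) : ℝ) - ((⌊a + s⌋ : ℤ) : ℝ) =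
        {s : ℝ | ⌊a + s⌋ ≠ ⌊b + s⌋}.indicator (fun _ => (1 : ℝ)) s := by
      intro s
      have h1 := Int.lt_floor_add_one (b + s)
      have h2 := Int.lt_floor_add_one (a + s)
      have h3 := Int.floor_le (a + s)
      have h4 := Int.floor_le (b + s)
      have hle : ⌊a + s⌋ ≤ ⌊b + s⌋ := Int.floor_mono (by linarith)
      have hlt : ⌊b + s⌋ < ⌊a + s⌋ + 2 := by
        have : ((⌊b + s⌋ : ℤ) : ℝ) < ⌊a + s⌋ + 2 := by linarith
        exact_mod_cast this
      by_cases hs : ⌊a + s⌋ = ⌊b + s⌋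
      · rw [Set.indicator_of_notMem (by simpa using hs), hs, sub_self]
      · rw [Set.indicator_of_mem (by simpa using hs)]
        have : ⌊b + s⌋ = ⌊a + s⌋ + 1 := by omega
        rw [this]
        push_cast
        ring
    have hI : ∫ s in (0 : ℝ)..1, (((⌊b + s⌋ : ℤ) : ℝ) - ((⌊a + s⌋ : ℤ) : ℝ)) = b - a := by
      rw [intervalIntegral.integral_sub (hbd b) (hbd a), integral_floor_add, integral_floor_add]
    simp_rw [hind] at hI
    rw [intervalIntegral.integral_of_le zero_le_one, integral_indicator_const _ hmeas] at hI
    rw [← hI, smul_eq_mul, mul_one, ofReal_measureReal]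

/-- A fair coin. -/
noncomputable def coin : Measure Bool := (2⁻¹ : ℝ≥0∞) • (Measure.dirac true + Measure.dirac false)

instance : IsProbabilityMeasure coin := by
  constructor
  simp only [coin, Measure.smul_apply, Measure.add_apply, measure_univ, smul_eq_mul,
    one_add_one_eq_two]
  exact ENNReal.inv_mul_cancel (by norm_num) (by norm_num)

lemma coin_singleton (e : Bool) : coin {e} = 2⁻¹ := by
  cases e <;> simp [coin]

/-- Independent fair coins, one for each cell of the grid. -/
noncomputable def cellCoins : Measure (ℤ → Bool) := Measure.infinitePi fun _ => coin

instance : IsProbabilityMeasure cellCoins := by unfold cellCoins; infer_instance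

lemma cellCoins_ne (m n : ℤ) :
    cellCoins {b | b m ≠ b n} = if m = n then 0 else 2⁻¹ := by
  split_ifs with h
  · simp [h]
  have hbox : ∀ e : Bool, cellCoins {b | b m = e ∧ b n = !e} = 4⁻¹ := by
    intro e
    have h' := Measure.infinitePi_pi (fun _ : ℤ => coin) (s := {m, n})
      (t := fun i => if i = m then {e} else {!e}) fun i _ => by
        split_ifs <;> exact MeasurableSet.singleton _
    rw [Finset.prod_pair h, if_pos rfl, if_neg (Ne.symm h), coin_singleton, coin_singleton,
      ← ENNReal.mul_inv (by simp) (by simp)] at h'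
    norm_num at h'
    rw [← h', cellCoins]
    congr 1
    ext b
    simp [Ne.symm h]
  have hU : {b : ℤ → Bool | b m ≠ b n} =
      {b | b m = true ∧ b n = !true} ∪ {b | b m = false ∧ b n = !false} := by
    ext b
    simp only [Set.mem_ofPred_eq, Set.mem_union]
    cases b m <;> cases b n <;> simp
  have hmeas : ∀ e : Bool, MeasurableSet {b : ℤ → Bool | b m = e ∧ b n = !e} := fun e =>
    (measurableSet_eq_fun (measurable_pi_apply m) measurable_const).inter
      (measurableSet_eq_fun (measurable_pi_apply n) measurable_const)
  rw [hU, measure_union _ (hmeas _), hbox, hbox]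
  · rw [← two_mul, show (4 : ℝ≥0∞) = 2 * 2 by norm_num, ENNReal.mul_inv (by simp) (by simp),
      ← mul_assoc, ENNReal.mul_inv_cancel (by simp) (by simp), one_mul]
  · rw [Set.disjoint_left]
    rintro b ⟨h1, _⟩ ⟨h2, _⟩
    rw [h1] at h2
    exact absurd h2 (by simp)

/-- The hash function given by a triple `ξ` of a linear functional, a shift of the grid of width `w`
(in units of `w`), and a coin for each cell: the coin of the cell that contains the value of the
functional. -/
noncomputable def gridHash {ρ : ℝ≥0∞} {d : ℕ} (w : ℝ)
    (ξ : (Fin d → ℝ) × ℝ × (ℤ → Bool)) (x : LpSpace ρ d) : Bool :=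
  ξ.2.2 ⌊(∑ i, ξ.1 i * x i) / w + ξ.2.1⌋

lemma measurable_coin_apply : Measurable fun p : (ℤ → Bool) × ℤ => p.1 p.2 :=
  measurable_from_prod_countable_left fun n => measurable_pi_apply n

lemma measurable_gridHash {ρ : ℝ≥0∞} {d : ℕ} (w : ℝ) :
    Measurable (gridHash (ρ := ρ) (d := d) w) := by
  refine measurable_pi_lambda _ fun x => ?_
  have h : Measurable fun ξ : (Fin d → ℝ) × ℝ × (ℤ → Bool) =>
      (ξ.2.2, ⌊(∑ i, ξ.1 i * x i) / w + ξ.2.1⌋) :=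
    Measurable.prodMk (by fun_prop) (Int.measurable_floor.comp (by fun_prop))
  exact measurable_coin_apply.comp h

/-- The law of `gridHash`, for a random functional with law `μ`, a uniform shift and fair coins. -/
noncomputable def gridLaw (ρ : ℝ≥0∞) {d : ℕ} (μ : Measure (Fin d → ℝ)) (w : ℝ) :
    Measure (LpSpace ρ d → Bool) :=
  (μ.prod ((volume.restrict (Set.Ioc (0 : ℝ) 1)).prod cellCoins)).map (gridHash w)

lemma isProbabilityMeasure_gridLaw (ρ : ℝ≥0∞) {d : ℕ} (μ : Measure (Fin d → ℝ))
    [IsProbabilityMeasure μ] (w : ℝ) : IsProbabilityMeasure (gridLaw ρ μ w) := by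
  have hP : IsProbabilityMeasure (volume.restrict (Set.Ioc (0 : ℝ) 1)) := ⟨by simp⟩
  exact Measure.isProbabilityMeasure_map (measurable_gridHash w).aemeasurable

lemma measurableSet_hash_eq {X : Type*} (x y : X) : MeasurableSet {h : X → Bool | h x = h y} :=
  measurableSet_eq_fun (measurable_pi_apply x) (measurable_pi_apply y)

/-- Two points collide unless they fall into different cells, which have different coins with
probability `1 / 2`. -/
lemma gridLaw_real_eq (ρ : ℝ≥0∞) {d : ℕ} (μ : Measure (Fin d → ℝ)) [IsProbabilityMeasure μ]
    {w : ℝ} (hw : 0 < w) (x y : LpSpace ρ d) :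
    (gridLaw ρ μ w).real {h | h x = h y} =
      1 - (∫ ω, min |∑ i, ω i * (x i - y i)| w ∂μ) / (2 * w) := by
  have hP : IsProbabilityMeasure (volume.restrict (Set.Ioc (0 : ℝ) 1)) := ⟨by simp⟩
  have := isProbabilityMeasure_gridLaw ρ μ w
  have hne : gridLaw ρ μ w {h | h x = h y}ᶜ =
      ∫⁻ ω, ENNReal.ofReal (min |∑ i, ω i * (x i - y i)| w / (2 * w)) ∂μ := by
    have hm := (measurableSet_hash_eq x y).compl
    rw [gridLaw, Measure.map_apply (measurable_gridHash w) hm,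
      Measure.prod_apply (measurable_gridHash w hm)]
    refine lintegral_congr fun ω => ?_
    rw [Measure.prod_apply (measurable_prodMk_left (measurable_gridHash w hm))]
    have hc : ∀ s : ℝ, cellCoins (Prod.mk s ⁻¹' (Prod.mk ω ⁻¹'
        (gridHash w ⁻¹' {h : LpSpace ρ d → Bool | h x = h y}ᶜ))) =
        {s : ℝ | ⌊(∑ i, ω i * x i) / w + s⌋ ≠ ⌊(∑ i, ω i * y i) / w + s⌋}.indicator
          (fun _ => (2⁻¹ : ℝ≥0∞)) s := by
      intro s
      have := cellCoins_ne ⌊(∑ i, ω i * x i) / w + s⌋ ⌊(∑ i, ω i * y i) / w + s⌋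
      rw [Set.indicator_apply]
      simp only [Set.mem_ofPred_eq, ne_eq, ite_not]
      exact this
    have hS : MeasurableSet
        {s : ℝ | ⌊(∑ i, ω i * x i) / w + s⌋ ≠ ⌊(∑ i, ω i * y i) / w + s⌋} :=
      (measurableSet_eq_fun (by fun_prop) (by fun_prop)).compl
    simp_rw [hc]
    rw [lintegral_indicator_const hS, measure_floor_ne, ← sub_div, ← Finset.sum_sub_distrib,
      abs_div, abs_of_pos hw]
    simp_rw [← mul_sub]
    rw [show (2⁻¹ : ℝ≥0∞) = ENNReal.ofReal 2⁻¹ by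
      rw [ENNReal.ofReal_inv_of_pos (by norm_num)]; norm_num, ← ENNReal.ofReal_mul (by norm_num)]
    congr 1
    conv_lhs => rw [← div_self hw.ne', min_div_div_right hw.le]
    field_simp
  have hnn : ∀ ω : Fin d → ℝ, 0 ≤ min |∑ i, ω i * (x i - y i)| w / (2 * w) := fun ω =>
    div_nonneg (le_min (abs_nonneg _) hw.le) (by positivity)
  have hint : Integrable (fun ω : Fin d → ℝ => min |∑ i, ω i * (x i - y i)| w / (2 * w)) μ := by
    refine Integrable.of_bound (C := 1) (Measurable.aestronglyMeasurable (by fun_prop)) ?_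
    filter_upwards with ω
    rw [Real.norm_eq_abs, abs_of_nonneg (hnn ω), div_le_one (by positivity)]
    linarith [min_le_right |∑ i, ω i * (x i - y i)| w]
  rw [← integral_div, ← compl_compl {h : LpSpace ρ d → Bool | h x = h y},
    probReal_compl_eq_one_sub (measurableSet_hash_eq x y).compl, measureReal_def, hne,
    ← ofReal_integral_eq_lintegral_ofReal hint (by filter_upwards with ω using hnn ω),
    ENNReal.toReal_ofReal (integral_nonneg hnn)]

/-- For all `ρ ∈ [1, 2]`, dimensions and `Δ` there is a family of hash functions for the `ℓ_ρ` norm,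
locality sensitive up to distance `Δ`, with a universal distortion. -/
theorem exists_isLSHFamily (ρ : ℝ≥0∞) [Fact (1 ≤ ρ)] (h2 : ρ ≤ 2) (d : ℕ) (Δ : ℝ) :
    ∃ H : Measure (LpSpace ρ d → Bool), IsLSHFamily H 960 Δ := by
  have hρt : ρ ≠ ∞ := ne_top_of_le_ne_top (by norm_num) h2
  have h1' : 1 ≤ ρ.toReal := by
    simpa using ENNReal.toReal_mono hρt (Fact.out : 1 ≤ ρ)
  have h2' : ρ.toReal ≤ 2 := by
    simpa using ENNReal.toReal_mono (by norm_num) h2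
  obtain ⟨μ, hμ, hint, a, ha, hb⟩ := exists_random_functional h1' h2' d
  obtain ⟨w, hw, htr⟩ := exists_truncation h1' ha μ hint (fun z => (hb z).1) (max Δ 1)
    (by positivity)
  refine ⟨gridLaw ρ μ w, isProbabilityMeasure_gridLaw ρ μ w, 240 * a / w, by positivity,
    fun x y => ?_⟩
  have hdist : dist x y = lpNorm ρ.toReal fun i => x i - y i := by
    rw [PiLp.dist_eq_sum (by linarith)]
    rfl
  rw [gridLaw_real_eq ρ μ hw, hdist]
  set z : Fin d → ℝ := fun i => x i - y i with hz
  have hup : ∫ ω, min |∑ i, ω i * (x i - y i)| w ∂μ ≤ 480 * a * lpNorm ρ.toReal z := by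
    refine le_trans (integral_mono_of_nonneg ?_ ?_ ?_) (hb z).2
    · filter_upwards with ω
      exact le_min (abs_nonneg _) hw.le
    · exact (integrable_finsetSum _ fun i _ => (hint i).mul_const _).abs
    · filter_upwards with ω
      exact min_le_left _ _
  have hlo : a / 2 * min (lpNorm ρ.toReal z) Δ ≤ ∫ ω, min |∑ i, ω i * (x i - y i)| w ∂μ := by
    refine le_trans ?_ (htr z)
    gcongr
    exact le_max_left _ _
  constructor
  · rw [sub_le_sub_iff_left, div_le_iff₀ (by positivity)]
    refine hup.trans_eq ?_
    field_simp
    ring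
  · rw [sub_le_sub_iff_left, le_div_iff₀ (by positivity)]
    refine le_trans (le_of_eq ?_) hlo
    field_simp
    ring

/-! ### Nearest neighbors in a random sample -/

section Sampling

variable {X : Type*} [MetricSpace X]

/-- The infimum defining the distance to the `k`-th nearest neighbor is attained. -/
lemma le_card_filter_kthDist {P : Finset X} {k : ℕ} (hkP : k ≤ P.card) (q : X) :
    k ≤ (P.filter fun p => dist p q ≤ kthDist P q k).card := by
  set S := {u : ℝ | k ≤ (P.filter fun p => dist p q ≤ u).card} with hS
  by_contra hlt
  have hne : (P.filter fun p => ¬ dist p q ≤ kthDist P q k).Nonempty := by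
    rw [Finset.nonempty_iff_ne_empty]
    intro h
    have := Finset.card_filter_add_card_filter_not (s := P) fun p => dist p q ≤ kthDist P q k
    rw [h, Finset.card_empty] at this
    omega
  obtain ⟨p₀, hp₀, hmin⟩ := Finset.exists_min_image _ (fun p => dist p q) hne
  rw [Finset.mem_filter, not_le] at hp₀
  obtain ⟨p₁, hp₁, hmax⟩ := Finset.exists_max_image P (fun p => dist p q) ⟨p₀, hp₀.1⟩
  have hSne : S.Nonempty := by
    refine ⟨dist p₁ q, ?_⟩
    rw [hS, Set.mem_ofPred_eq, Finset.filter_true_of_mem hmax]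
    exact hkP
  have hle : dist p₀ q ≤ sInf S := by
    refine le_csInf hSne fun u hu => ?_
    by_contra! hu'
    refine hlt (le_trans hu (Finset.card_le_card fun p hp => ?_))
    rw [Finset.mem_filter] at hp ⊢
    refine ⟨hp.1, ?_⟩
    by_contra hpq
    have := hmin p (Finset.mem_filter.2 ⟨hp.1, hpq⟩)
    linarith [hp.2]
  exact absurd hle (not_le.2 hp₀.2)

lemma kthDist_nonneg {P : Finset X} {k : ℕ} (hk : 1 ≤ k) (q : X) : 0 ≤ kthDist P q k := by
  refine Real.sInf_nonneg fun u hu => ?_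
  obtain ⟨p, hp⟩ := Finset.card_pos.1 (lt_of_lt_of_le hk hu)
  exact dist_nonneg.trans (Finset.mem_filter.1 hp).2

lemma choose_sub_mul_pow_le (n k m : ℕ) :
    (n - k).choose m * n ^ m ≤ n.choose m * (n - k) ^ m := by
  induction m with
  | zero => simp
  | succ m ih =>
    have key : (n - k - m) * n ≤ (n - m) * (n - k) := by
      rcases le_or_gt (n - k) m with h | h
      · rw [Nat.sub_eq_zero_of_le h, zero_mul]
        exact Nat.zero_le _
      · obtain ⟨j, hj⟩ := Nat.exists_eq_add_of_lt h
        have e2 : n = m + j + 1 + k := by omega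
        subst e2
        have e3 : m + j + 1 + k - k = m + j + 1 := by omega
        have e4 : m + j + 1 - m = j + 1 := by omega
        have e5 : m + j + 1 + k - m = j + 1 + k := by omega
        rw [e3, e4, e5]
        nlinarith [Nat.zero_le (k * m)]
    refine Nat.le_of_mul_le_mul_right ?_ (Nat.succ_pos m)
    calc (n - k).choose (m + 1) * n ^ (m + 1) * (m + 1)
        = ((n - k).choose (m + 1) * (m + 1)) * n ^ m * n := by ring
      _ = ((n - k).choose m * n ^ m) * ((n - k - m) * n) := by
          rw [Nat.choose_succ_right_eq]; ring
      _ ≤ (n.choose m * (n - k) ^ m) * ((n - m) * (n - k)) := Nat.mul_le_mul ih key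
      _ = (n.choose (m + 1) * (m + 1)) * (n - k) ^ (m + 1) := by
          rw [Nat.choose_succ_right_eq]; ring
      _ = n.choose (m + 1) * (n - k) ^ (m + 1) * (m + 1) := by ring

/-- The probability `(1 - x) ^ m` is smaller than `exp (- m x)` by a factor bounded away from `1`.
This factor leaves room for the failure probability of the hashing. -/
lemma one_sub_pow_le {x : ℝ} (h0 : 0 ≤ x) (h1 : x ≤ 1) {m : ℕ} (hm : 1 ≤ m) :
    (1 - x) ^ m ≤ (1 - x ^ 2 / 4) * Real.exp (-(m * x)) := by
  have hx : 1 - x ≤ (1 - x ^ 2 / 4) * Real.exp (-x) := by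
    have h2 : (1 - x / 2) ^ 2 ≤ Real.exp (-x) := by
      have h := Real.add_one_le_exp (-(x / 2))
      have e : Real.exp (-x) = Real.exp (-(x / 2)) ^ 2 := by
        rw [← Real.exp_nat_mul]
        congr 1
        push_cast
        ring
      rw [e]
      exact pow_le_pow_left₀ (by linarith) (by linarith) 2
    have h3 : Real.exp (-x) ≤ 1 := Real.exp_le_one_iff.2 (by linarith)
    nlinarith [sq_nonneg x]
  have hx4 : 0 ≤ 1 - x ^ 2 / 4 := by nlinarith
  calc (1 - x) ^ m ≤ ((1 - x ^ 2 / 4) * Real.exp (-x)) ^ m :=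
        pow_le_pow_left₀ (by linarith) hx m
    _ = (1 - x ^ 2 / 4) ^ m * Real.exp (-(m * x)) := by
        rw [mul_pow, ← Real.exp_nat_mul]
        congr 2
        ring
    _ ≤ (1 - x ^ 2 / 4) * Real.exp (-(m * x)) := by
        gcongr
        exact pow_le_of_le_one hx4 (by nlinarith) (by omega)

/-- A random subset of size `m` misses the `k` nearest neighbors of `q` with probability at most
`(1 - 1 / (4 n²)) δ`. -/
lemma card_powersetCard_miss_le {P : Finset X} {m k : ℕ} (hm : 1 ≤ m) (hmP : m ≤ P.card)
    {δ : ℝ} (hδ : 0 < δ) (hk1 : 1 ≤ k) (hk : Real.log δ⁻¹ * ((P.card : ℝ) / m) ≤ k)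
    (hkP : k ≤ P.card) (q : X) :
    (((P.filter fun p => ¬ dist p q ≤ kthDist P q k).powersetCard m).card : ℝ) ≤
      (1 - 1 / (4 * (P.card : ℝ) ^ 2)) * δ * (P.powersetCard m).card := by
  set n := P.card with hn
  have hn0 : (0 : ℝ) < n := by exact_mod_cast (by omega : 0 < n)
  have hm0 : (0 : ℝ) < m := by exact_mod_cast hm
  have hcard : (P.filter fun p => ¬ dist p q ≤ kthDist P q k).card ≤ n - k := by
    have h1 := Finset.card_filter_add_card_filter_not (s := P) fun p => dist p q ≤ kthDist P q k
    have h2 := le_card_filter_kthDist hkP q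
    omega
  rw [Finset.card_powersetCard, Finset.card_powersetCard]
  have hx0 : (0 : ℝ) ≤ (k : ℝ) / n := by positivity
  have hx1 : (k : ℝ) / n ≤ 1 := (div_le_one hn0).2 (by exact_mod_cast hkP)
  have h1 : ((n - k).choose m : ℝ) ≤ (1 - (k : ℝ) / n) ^ m * n.choose m := by
    have h := choose_sub_mul_pow_le n k m
    have h' : ((n - k).choose m : ℝ) * (n : ℝ) ^ m ≤ n.choose m * ((n : ℝ) - k) ^ m := by
      have := (Nat.cast_le (α := ℝ)).2 h
      push_cast [Nat.cast_sub hkP] at this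
      exact this
    have e : (1 - (k : ℝ) / n) = ((n : ℝ) - k) / n := by field_simp
    rw [e, div_pow, div_mul_eq_mul_div, le_div_iff₀ (by positivity)]
    linarith
  have hexp : Real.exp (-(m * ((k : ℝ) / n))) ≤ δ := by
    rw [← Real.le_log_iff_exp_le hδ]
    rw [Real.log_inv] at hk
    have : -Real.log δ * n ≤ k * m := by
      have := mul_le_mul_of_nonneg_right hk hm0.le
      rwa [mul_assoc, div_mul_cancel₀ _ hm0.ne'] at this
    rw [neg_le, ← mul_div_assoc, le_div_iff₀ hn0]
    linarith
  have hk1' : (1 : ℝ) ≤ k := by exact_mod_cast hk1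
  have hsq : 1 - ((k : ℝ) / n) ^ 2 / 4 ≤ 1 - 1 / (4 * (n : ℝ) ^ 2) := by
    have : 1 / (4 * (n : ℝ) ^ 2) ≤ ((k : ℝ) / n) ^ 2 / 4 := by
      rw [div_pow, div_div, mul_comm (4 : ℝ)]
      gcongr
      nlinarith
    linarith
  have hpos : 0 ≤ 1 - ((k : ℝ) / n) ^ 2 / 4 := by nlinarith
  calc (((P.filter fun p => ¬ dist p q ≤ kthDist P q k).card.choose m : ℕ) : ℝ)
      ≤ ((n - k).choose m : ℝ) := by exact_mod_cast Nat.choose_le_choose m hcard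
    _ ≤ (1 - (k : ℝ) / n) ^ m * n.choose m := h1
    _ ≤ ((1 - ((k : ℝ) / n) ^ 2 / 4) * Real.exp (-(m * ((k : ℝ) / n)))) * n.choose m := by
        gcongr
        exact one_sub_pow_le hx0 hx1 hm
    _ ≤ ((1 - 1 / (4 * (n : ℝ) ^ 2)) * δ) * n.choose m := by
        have := Real.exp_pos (-(m * ((k : ℝ) / n)))
        gcongr
        linarith

end Sampling

/-! ### Amplification by prefixes and repetitions -/

section Amplification

lemma pi_real_sharePrefix {X : Type*} (H : Measure (X → Bool)) [IsProbabilityMeasure H] {l t : ℕ}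
    (hl : l ≤ t) (x y : X) :
    (Measure.pi fun _ : Fin t => H).real {h | SharePrefix h l x y} =
      H.real {h | h x = h y} ^ l := by
  have e : {h : Fin t → X → Bool | SharePrefix h l x y} =
      Set.univ.pi fun i : Fin t => if (i : ℕ) < l then {h | h x = h y} else Set.univ := by
    ext h
    simp only [SharePrefix, Set.mem_ofPred_eq, Set.mem_univ_pi]
    refine forall_congr' fun i => ?_
    split_ifs with hi <;> simp [hi]
  have e2 : ∀ i : Fin t, H (if (i : ℕ) < l then {h | h x = h y} else Set.univ) =
      if (i : ℕ) < l then H {h | h x = h y} else 1 := fun i => by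
    split_ifs <;> simp
  rw [measureReal_def, e, Measure.pi_pi, Finset.prod_congr rfl fun i _ => e2 i,
    Fin.prod_univ_eq_prod_range (fun i => if i < l then H {h | h x = h y} else 1) t,
    Finset.prod_ite, Finset.prod_const, Finset.prod_const_one, mul_one, ENNReal.toReal_pow,
    measureReal_def]
  congr 1
  rw [show (Finset.range t).filter (fun i => i < l) = Finset.range l by
    ext i
    simp only [Finset.mem_filter, Finset.mem_range]
    omega, Finset.card_range]

lemma measurableSet_sharePrefix {X : Type*} (t l : ℕ) (x y : X) :
    MeasurableSet {h : Fin t → X → Bool | SharePrefix h l x y} := by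
  have : {h : Fin t → X → Bool | SharePrefix h l x y} =
      ⋂ i : Fin t, ⋂ _ : (i : ℕ) < l, {h | h i x = h i y} := by
    ext h
    simp [SharePrefix]
  rw [this]
  exact MeasurableSet.iInter fun i => MeasurableSet.iInter fun _ =>
    measurableSet_eq_fun (by fun_prop) (by fun_prop)

variable {X : Type*} [MetricSpace X]

/-- If at some prefix length `l` a point `p` of the index shares the prefix of `q` with probability
at least `y`, and the points farther than `g` do so with total probability at most `y / 2`, then all
`r` independent repetitions retrieve only such far points with probability at most
`(1 - y / 2) ^ r`. -/
lemma hashLaw_all_far_le (H : Measure (X → Bool)) [IsProbabilityMeasure H] {r t l W : ℕ}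
    (hl : l ≤ t) {R : Finset X} {p q : X} (hp : p ∈ R) {g y b : ℝ}
    (hy : y ≤ H.real {h | h p = h q} ^ l)
    (hb : ∀ v ∈ R, g < dist v q → H.real {h | h v = h q} ^ l ≤ b) (hb0 : 0 ≤ b)
    (hRb : R.card * b ≤ y / 2) :
    hashLaw H r t {h | ∃ Q : Finset X, IsRetrieved h R W q Q ∧ ∀ v ∈ Q, g < dist v q} ≤
      ENNReal.ofReal ((1 - y / 2) ^ r) := by
  classical
  set F := R.filter fun v => g < dist v q with hF
  set μ : Measure (Fin t → X → Bool) := Measure.pi fun _ => H with hμ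
  set G : Set (Fin t → X → Bool) := {h | SharePrefix h l p q}ᶜ ∪
    ⋃ v ∈ F, {h | SharePrefix h l v q} with hG
  have hGle : μ.real G ≤ 1 - y / 2 := by
    calc μ.real G ≤ μ.real {h | SharePrefix h l p q}ᶜ +
          μ.real (⋃ v ∈ F, {h | SharePrefix h l v q}) := measureReal_union_le _ _
      _ ≤ (1 - y) + ∑ v ∈ F, μ.real {h | SharePrefix h l v q} := by
          gcongr
          · rw [probReal_compl_eq_one_sub (measurableSet_sharePrefix t l p q), hμ,
              pi_real_sharePrefix H hl]
            linarith
          · exact measureReal_biUnion_finset_le _ _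
      _ ≤ (1 - y) + ∑ v ∈ F, b := by
          gcongr with v hv
          rw [hμ, pi_real_sharePrefix H hl]
          rw [hF, Finset.mem_filter] at hv
          exact hb v hv.1 hv.2
      _ ≤ (1 - y) + R.card * b := by
          rw [Finset.sum_const, nsmul_eq_mul]
          gcongr
          exact Finset.filter_subset _ _
      _ ≤ 1 - y / 2 := by linarith
  have hsub : {h : Fin r → Fin t → X → Bool |
      ∃ Q : Finset X, IsRetrieved h R W q Q ∧ ∀ v ∈ Q, g < dist v q} ⊆
      Set.univ.pi fun _ => G := by
    rintro h ⟨Q, ⟨I, τ, hI, hτ, hQ⟩, hfar⟩ j -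
    rw [hG, Set.mem_union, or_iff_not_imp_left]
    intro hpj
    have hpj' : SharePrefix (h j) l p q := by simpa using hpj
    obtain ⟨a, ha⟩ : p ∈ Set.range (I j) := by
      rw [(hI j).range_eq]
      exact hp
    have hv : I j (τ j) ∈ R := by
      have : I j (τ j) ∈ Set.range (I j) := ⟨_, rfl⟩
      rwa [(hI j).range_eq] at this
    have hvQ : I j (τ j) ∈ Q := (hQ _).2 ⟨j, τ j, by omega, by omega, rfl⟩
    rw [Set.mem_iUnion₂]
    exact ⟨_, Finset.mem_filter.2 ⟨hv, hfar _ hvQ⟩, hτ j a l (by rw [ha]; exact hpj')⟩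
  calc hashLaw H r t _ ≤ hashLaw H r t (Set.univ.pi fun _ => G) := measure_mono hsub
    _ = μ G ^ r := by rw [hashLaw, Measure.pi_pi]; simp [hμ]
    _ ≤ ENNReal.ofReal ((1 - y / 2) ^ r) := by
        rw [← ofReal_measureReal (μ := μ) (s := G), ← ENNReal.ofReal_pow measureReal_nonneg]
        exact ENNReal.ofReal_le_ofReal (pow_le_pow_left₀ measureReal_nonneg hGle r)

/-- The choice of the prefix length: a point `p` within distance `u` of `q` shares it with
probability at least `n ^ (-1/(2c))`, a point at distance more than `48 C c u` with probability at
most `n ^ (-3)`, where `L = log n`. -/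
lemma exists_prefix_length {H : Measure (X → Bool)} {C Δ lam c L u ε : ℝ} (hC : 1 ≤ C)
    (hc : 1 < c) (hlam : 0 < lam)
    (hH : ∀ x y : X, 1 - lam * dist x y ≤ H.real {h | h x = h y} ∧
      H.real {h | h x = h y} ≤ 1 - lam * min (dist x y) Δ / C)
    {P : Finset X} (hΔ : ∀ x ∈ P, ∀ y ∈ P, dist x y ≤ Δ) (hε : 0 < ε)
    (hsep : ∀ x ∈ P, ∀ y ∈ P, x ≠ y → ε ≤ dist x y) (hL : 1 / 2 ≤ L) {t : ℕ}
    (ht : 6 * C * L ≤ lam * ε * t) {p q : X} (hp : p ∈ P) (hu : 0 ≤ u) (hpq : dist p q ≤ u) :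
    ∃ l ≤ t, Real.exp (-(L / (2 * c))) ≤ H.real {h | h p = h q} ^ l ∧
      ∀ v ∈ P, 48 * C * c * u < dist v q →
        H.real {h | h v = h q} ^ l ≤ Real.exp (-(3 * L)) := by
  have hL0 : 0 < L := by linarith
  have hc0 : 0 < c := by linarith
  have hC0 : 0 < C := by linarith
  have hCc : 1 ≤ C * c := by nlinarith
  by_cases hfar : ∃ v ∈ P, 48 * C * c * u < dist v q
  swap
  · push Not at hfar
    refine ⟨0, Nat.zero_le _, ?_, fun v hv h => absurd h (not_lt.2 (hfar v hv))⟩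
    rw [pow_zero]
    exact Real.exp_le_one_iff.2 (by rw [neg_nonpos]; positivity)
  -- the truncation of the distances at `Δ` does no harm to the far points
  have hmin : ∀ v ∈ P, 48 * C * c * u < dist v q → 47 * C * c * u ≤ min (dist v q) Δ := by
    intro v hv h
    have h1 := dist_triangle_right v q p
    have h2 := hΔ v hv p hp
    have h3 : u ≤ C * c * u := le_mul_of_one_le_left hu hCc
    have h4 := dist_triangle v p q
    exact le_min (by nlinarith) (by nlinarith)
  have hprob : ∀ v ∈ P, 48 * C * c * u < dist v q →
      H.real {h | h v = h q} ≤ 1 - 47 * c * lam * u := by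
    intro v hv h
    refine (hH v q).2.trans ?_
    have := mul_le_mul_of_nonneg_left (hmin v hv h) hlam.le
    have h' : 47 * c * lam * u ≤ lam * min (dist v q) Δ / C := by
      rw [le_div_iff₀ hC0]
      linarith
    linarith
  have hsmall : 47 * c * lam * u ≤ 1 := by
    obtain ⟨v, hv, h⟩ := hfar
    have := hprob v hv h
    have : 0 ≤ H.real {h | h v = h q} := measureReal_nonneg
    linarith
  have hlu0 : 0 ≤ lam * u := by positivity
  have hlu : lam * u ≤ 1 / 47 := by nlinarith
  have hnear : ∀ l : ℕ, 4 * c * lam * u * l ≤ L →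
      Real.exp (-(L / (2 * c))) ≤ H.real {h | h p = h q} ^ l := by
    intro l hl
    -- `1 - x ≥ exp (-2 x)` for small `x`
    have h1 : Real.exp (-(2 * (lam * u))) ≤ H.real {h | h p = h q} := by
      have h2 : lam * dist p q ≤ lam * u := by gcongr
      refine le_trans ?_ (hH p q).1
      set x := lam * u
      have h3 := Real.add_one_le_exp (2 * x)
      have h4 : Real.exp (-(2 * x)) ≤ 1 - x := by
        rw [Real.exp_neg, inv_le_iff_one_le_mul₀ (Real.exp_pos _)]
        nlinarith
      linarith
    calc Real.exp (-(L / (2 * c))) ≤ Real.exp (-(2 * (lam * u))) ^ l := by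
          rw [← Real.exp_nat_mul]
          refine Real.exp_le_exp.2 ?_
          have : 2 * (lam * u) * l ≤ L / (2 * c) := by
            rw [le_div_iff₀ (by positivity)]
            linarith
          linarith
      _ ≤ _ := pow_le_pow_left₀ (Real.exp_pos _).le h1 l
  have hpow : ∀ (x s : ℝ) (l : ℕ), 0 ≤ x → x ≤ 1 - s → 3 * L ≤ s * l →
      x ^ l ≤ Real.exp (-(3 * L)) := by
    intro x s l hx0 hx hs
    calc x ^ l ≤ Real.exp (-s) ^ l :=
          pow_le_pow_left₀ hx0 (by linarith [Real.add_one_le_exp (-s)]) l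
      _ ≤ _ := by
          rw [← Real.exp_nat_mul]
          exact Real.exp_le_exp.2 (by linarith)
  rcases le_or_gt (4 * c * lam * u * t) L with hA | hB
  · -- `u` is so small that the full keys separate `p` from all other points
    refine ⟨t, le_rfl, hnear t hA, fun v hv h => ?_⟩
    have hvp : v ≠ p := by
      rintro rfl
      nlinarith
    have hlt : 0 < lam * t := by
      have : 0 < lam * ε * t := lt_of_lt_of_le (by positivity) ht
      have h' : 0 < lam * t * ε := by linarith
      exact pos_of_mul_pos_left h' hε.le
    have huε : 24 * (C * c) * u ≤ ε := by
      refine le_of_mul_le_mul_left ?_ hlt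
      have := mul_le_mul_of_nonneg_left hA (show 0 ≤ 6 * C by positivity)
      linarith
    have huε' : u ≤ ε / 2 := by nlinarith
    have h1 := hsep v hv p hp hvp
    have h2 := dist_triangle_right v p q
    have h3 := hΔ v hv p hp
    have h4 : ε / 2 ≤ min (dist v q) Δ := le_min (by linarith) (by linarith)
    refine hpow _ (lam * (ε / 2) / C) t measureReal_nonneg ((hH v q).2.trans ?_) ?_
    · gcongr
    · rw [div_mul_eq_mul_div, le_div_iff₀ hC0]
      linarith
  · have hu0 : 0 < u := by
      rcases hu.eq_or_lt with rfl | h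
      · simp at hB
        linarith
      · exact h
    have hd : 0 < 4 * c * lam * u := by positivity
    have hquot : 1 ≤ L / (4 * c * lam * u) := by
      rw [le_div_iff₀ hd]
      linarith
    have hfl : (⌊L / (4 * c * lam * u)⌋₊ : ℝ) ≤ L / (4 * c * lam * u) :=
      Nat.floor_le (by positivity)
    have hfl' := Nat.lt_floor_add_one (L / (4 * c * lam * u))
    have hfl1 : (1 : ℝ) ≤ ⌊L / (4 * c * lam * u)⌋₊ := by
      exact_mod_cast Nat.one_le_floor_iff _ |>.2 hquot
    refine ⟨⌊L / (4 * c * lam * u)⌋₊, ?_, hnear _ ?_, fun v hv h => ?_⟩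
    · have : (⌊L / (4 * c * lam * u)⌋₊ : ℝ) ≤ t := hfl.trans (by
        rw [div_le_iff₀ hd]
        linarith)
      exact_mod_cast this
    · rw [le_div_iff₀ hd] at hfl
      linarith
    · refine hpow _ _ _ measureReal_nonneg (hprob v hv h) ?_
      rw [div_lt_iff₀ hd] at hfl'
      nlinarith

/-- With `⌈4 c (κ + 4) n ^ (1 / c)⌉` repetitions, the probability of retrieving only points at
distance more than `48 C c u` is at most `n ^ (-(κ + 4))`, as soon as the index holds a point within
distance `u`. -/
lemma hashLaw_far_le {H : Measure (X → Bool)} [IsProbabilityMeasure H] {C Δ lam c u ε : ℝ}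
    (hC : 1 ≤ C) (hc : 1 < c) (hlam : 0 < lam)
    (hH : ∀ x y : X, 1 - lam * dist x y ≤ H.real {h | h x = h y} ∧
      H.real {h | h x = h y} ≤ 1 - lam * min (dist x y) Δ / C)
    {P R : Finset X} (hΔ : ∀ x ∈ P, ∀ y ∈ P, dist x y ≤ Δ) (hε : 0 < ε)
    (hsep : ∀ x ∈ P, ∀ y ∈ P, x ≠ y → ε ≤ dist x y) (hn : 2 ≤ P.card) {t : ℕ}
    (ht : 6 * C * Real.log P.card ≤ lam * ε * t) (hRP : R ⊆ P) {p q : X} (hp : p ∈ R)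
    (hu : 0 ≤ u) (hpq : dist p q ≤ u) (κ W : ℕ) :
    hashLaw H ⌈4 * c * (κ + 4) * (P.card : ℝ) ^ (1 / c)⌉₊ t
      {h | ∃ Q : Finset X, IsRetrieved h R W q Q ∧ ∀ v ∈ Q, 48 * C * c * u < dist v q} ≤
      ENNReal.ofReal (1 / (P.card : ℝ) ^ (κ + 4)) := by
  have hn2 : (2 : ℝ) ≤ P.card := by exact_mod_cast hn
  have hn0 : (0 : ℝ) < P.card := by linarith
  set L := Real.log P.card with hLdef
  have hc0 : 0 < c := by linarith
  have hexpL : Real.exp L = P.card := Real.exp_log hn0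
  have hL : 1 / 2 ≤ L := by
    have := Real.log_le_log (by norm_num) hn2
    linarith [Real.log_two_gt_d9]
  obtain ⟨l, hl, hnear, hfar⟩ := exists_prefix_length hC hc hlam hH hΔ hε hsep hL ht (hRP hp) hu hpq
  set y := Real.exp (-(L / (2 * c))) with hy
  have hy0 : 0 < y := Real.exp_pos _
  have hy1 : y ≤ 1 := Real.exp_le_one_iff.2 (by rw [neg_nonpos]; positivity)
  have hyL : Real.exp (-L) ≤ y := by
    refine Real.exp_le_exp.2 (neg_le_neg ?_)
    rw [div_le_iff₀ (by positivity)]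
    nlinarith
  have hRb : R.card * Real.exp (-(3 * L)) ≤ y / 2 := by
    have hRc : (R.card : ℝ) ≤ Real.exp L := by
      rw [hexpL]
      exact_mod_cast Finset.card_le_card hRP
    have hneg : Real.exp (-L) ≤ 1 / 2 := by
      rw [Real.exp_neg, hexpL, one_div]
      gcongr
    calc R.card * Real.exp (-(3 * L)) ≤ Real.exp L * Real.exp (-(3 * L)) := by gcongr
      _ = Real.exp (-L) * Real.exp (-L) := by rw [← Real.exp_add, ← Real.exp_add]; ring_nf
      _ ≤ y * (1 / 2) := by gcongr
      _ = y / 2 := by ring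
  refine (hashLaw_all_far_le H hl hp hnear (fun v hv => hfar v (hRP hv)) (Real.exp_pos _).le
    hRb).trans (ENNReal.ofReal_le_ofReal ?_)
  set r := ⌈4 * c * (κ + 4) * (P.card : ℝ) ^ (1 / c)⌉₊ with hr
  have hrle : 4 * c * (κ + 4) * (P.card : ℝ) ^ (1 / c) ≤ r := Nat.le_ceil _
  have hpow : (P.card : ℝ) ^ (1 / c) = Real.exp (L / (2 * c)) * Real.exp (L / (2 * c)) := by
    rw [Real.rpow_def_of_pos hn0, ← Real.exp_add]
    congr 1
    field_simp
    ring
  have hmain : (κ + 4) * L ≤ y / 2 * r := by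
    have h1 : L / (2 * c) ≤ Real.exp (L / (2 * c)) := by
      linarith [Real.add_one_le_exp (L / (2 * c))]
    rw [div_le_iff₀ (by positivity)] at h1
    calc (κ + 4) * L ≤ (κ + 4) * (Real.exp (L / (2 * c)) * (2 * c)) := by gcongr
      _ = y / 2 * (4 * c * (κ + 4) * (P.card : ℝ) ^ (1 / c)) := by
          have : y * Real.exp (L / (2 * c)) = 1 := by rw [hy, ← Real.exp_add]; simp
          rw [hpow]
          linear_combination (-(2 * c * (κ + 4) * Real.exp (L / (2 * c)))) * this
      _ ≤ y / 2 * r := by gcongr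
  calc (1 - y / 2) ^ r ≤ Real.exp (-(y / 2)) ^ r :=
        pow_le_pow_left₀ (by linarith) (by linarith [Real.add_one_le_exp (-(y / 2))]) r
    _ = Real.exp (-(y / 2 * r)) := by rw [← Real.exp_nat_mul]; ring_nf
    _ ≤ Real.exp (-((κ + 4) * L)) := Real.exp_le_exp.2 (neg_le_neg hmain)
    _ = 1 / (P.card : ℝ) ^ (κ + 4) := by
        rw [Real.exp_neg, ← hexpL, ← Real.exp_nat_mul, one_div]
        push_cast
        rfl

end Amplification

/-! ### Ranking and failure probability -/

section Ranking

variable {X : Type*} [MetricSpace X]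

lemma IsRetrieved.subset {X : Type*} {r t : ℕ} {h : Fin r → Fin t → X → Bool}
    {R : Finset X} {W : ℕ} {q : X} {Q : Finset X} (hQ : IsRetrieved h R W q Q) : Q ⊆ R := by
  obtain ⟨I, τ, hI, -, hQ⟩ := hQ
  intro x hx
  obtain ⟨j, a, -, -, rfl⟩ := (hQ x).1 hx
  have : I j a ∈ Set.range (I j) := ⟨_, rfl⟩
  rwa [(hI j).range_eq] at this

lemma IsRetrieved.card_le {X : Type*} {r t : ℕ} {h : Fin r → Fin t → X → Bool}
    {R : Finset X} {W : ℕ} {q : X} {Q : Finset X} (hQ : IsRetrieved h R W q Q) :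
    Q.card ≤ r * (2 * W + 1) := by
  classical
  obtain ⟨I, τ, -, -, hQ⟩ := hQ
  set A : Fin r → Finset (Fin R.card) := fun j =>
    Finset.univ.filter fun a => (τ j : ℕ) ≤ a + W ∧ (a : ℕ) ≤ τ j + W with hA
  have hsub : Q ⊆ Finset.univ.biUnion fun j => (A j).image (I j) := by
    intro x hx
    obtain ⟨j, a, h1, h2, rfl⟩ := (hQ x).1 hx
    exact Finset.mem_biUnion.2 ⟨j, Finset.mem_univ _, Finset.mem_image_of_mem _
      (Finset.mem_filter.2 ⟨Finset.mem_univ _, h1, h2⟩)⟩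
  have hcard : ∀ j, (A j).card ≤ 2 * W + 1 := by
    intro j
    calc (A j).card ≤ (Finset.Icc ((τ j : ℕ) - W) (τ j + W)).card := by
          refine Finset.card_le_card_of_injOn (fun a => (a : ℕ)) (fun a ha => ?_)
            fun a _ b _ hab => Fin.ext hab
          have := (Finset.mem_filter.1 ha).2
          simp only [Finset.coe_Icc, Set.mem_Icc]
          omega
      _ ≤ 2 * W + 1 := by rw [Nat.card_Icc]; omega
  calc Q.card ≤ (Finset.univ.biUnion fun j => (A j).image (I j)).card := Finset.card_le_card hsub
    _ ≤ ∑ j : Fin r, ((A j).image (I j)).card := Finset.card_biUnion_le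
    _ ≤ ∑ _j : Fin r, (2 * W + 1) :=
        Finset.sum_le_sum fun j _ => Finset.card_image_le.trans (hcard j)
    _ = r * (2 * W + 1) := by simp

lemma minDist_le {Q : Finset X} {q v : X} (hv : v ∈ Q) : minDist Q q ≤ edist q v :=
  iInf₂_le v hv

lemma exists_minDist_eq {Q : Finset X} (hQ : Q.Nonempty) (q : X) :
    ∃ v ∈ Q, minDist Q q = edist q v := by
  obtain ⟨v, hv, hmin⟩ := Finset.exists_min_image Q (fun v => edist q v) hQ
  exact ⟨v, hv, le_antisymm (minDist_le hv) (le_iInf₂ hmin)⟩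

lemma TopByDistance.exists_near {s : ℕ} {shard : X → Fin s} {q : X} {Q : Finset X} {i : Fin s}
    (hi : TopByDistance shard q Q i) {g : ℝ} {v : X} (hv : v ∈ Q) (hvg : dist v q ≤ g) :
    ∃ p ∈ Q, shard p = i ∧ dist p q ≤ g := by
  have h1 : minDist (Q.filter fun x => shard x = i) q ≤ edist q v :=
    (hi (shard v)).trans (minDist_le (Finset.mem_filter.2 ⟨hv, rfl⟩))
  have hne : (Q.filter fun x => shard x = i).Nonempty := by
    rw [Finset.nonempty_iff_ne_empty]
    intro h
    rw [h] at h1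
    simp [minDist, edist_ne_top] at h1
  obtain ⟨p, hp, hpe⟩ := exists_minDist_eq hne q
  rw [Finset.mem_filter] at hp
  refine ⟨p, hp.1, hp.2, ?_⟩
  rw [hpe, edist_dist, edist_dist, ENNReal.ofReal_le_ofReal_iff dist_nonneg] at h1
  rw [dist_comm]
  exact h1.trans (by rwa [dist_comm])

lemma vote_of_ne_top {σ : ℝ≥0∞} (hσ : σ ≠ ∞) (q v : X) :
    vote σ q v = ENNReal.ofReal (Real.exp (-(σ.toReal * dist v q ^ 2))) := by
  have h : σ * edist q v ^ 2 = ENNReal.ofReal (σ.toReal * dist v q ^ 2) := by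
    rw [ENNReal.ofReal_mul ENNReal.toReal_nonneg, ENNReal.ofReal_toReal hσ, edist_dist, dist_comm,
      ENNReal.ofReal_pow dist_nonneg]
  rw [vote, h, EReal.coe_ennreal_ofReal, max_eq_left (by positivity), ← EReal.coe_neg,
    EReal.exp_coe]

lemma vote_top_of_ne {q v : X} (h : q ≠ v) : vote ⊤ q v = 0 := by
  have : edist q v ^ 2 ≠ 0 := pow_ne_zero 2 (by simpa using h)
  rw [vote, ENNReal.top_mul this]
  simp

/-- If a retrieved point is within distance `g` of `q`, then the shard with the highest voting power
contains a retrieved point within distance `a g`, once `a ^ 2 - 1` exceeds the logarithm of the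
number of retrieved points: otherwise all votes in that shard together are outweighed by the single
vote of the nearest retrieved point. -/
lemma TopByVotes.exists_near {s : ℕ} {shard : X → Fin s} {q : X} {Q : Finset X} {i : Fin s}
    (hi : TopByVotes shard q Q i) {g a : ℝ} {v : X} (hv : v ∈ Q) (hvg : dist v q ≤ g) (ha : 0 ≤ a)
    (hQa : Real.log Q.card + 1 < a ^ 2) :
    ∃ p ∈ Q, shard p = i ∧ dist p q ≤ a * g := by
  obtain ⟨σ, hσ, hi⟩ := hi
  obtain ⟨w, hw, hwe⟩ := exists_minDist_eq ⟨v, hv⟩ q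
  by_contra! hfar
  have hwg : dist w q ≤ g := by
    have h := minDist_le (q := q) hv
    rw [hwe, edist_dist, edist_dist, ENNReal.ofReal_le_ofReal_iff dist_nonneg] at h
    rw [dist_comm w q]
    rw [dist_comm v q] at hvg
    exact h.trans hvg
  have hfar' : ∀ p ∈ Q.filter fun x => shard x = i, a * dist w q < dist p q := fun p hp => by
    rw [Finset.mem_filter] at hp
    exact (mul_le_mul_of_nonneg_left hwg ha).trans_lt (hfar p hp.1 hp.2)
  have hpow : vote σ q w ≤ votingPower shard σ q Q i := by
    refine le_trans ?_ (hi (shard w))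
    exact Finset.single_le_sum (f := fun v => vote σ q v) (fun _ _ => zero_le)
      (Finset.mem_filter.2 ⟨hw, rfl⟩)
  refine absurd hpow (not_le.2 ?_)
  rcases eq_or_ne w q with rfl | hwq
  · -- the infinite scaling factor: only points at distance `0` vote
    have hσt : σ = ⊤ := by
      have := hσ.1
      rw [hwe] at this
      simpa using this
    have h0 : votingPower shard σ w Q i = 0 := by
      refine Finset.sum_eq_zero fun p hp => ?_
      rw [hσt]
      refine vote_top_of_ne ?_
      rintro rfl
      simpa using hfar' w hp
    rw [h0, hσt]
    simp [vote]
  · have hD : 0 < dist w q := dist_pos.2 hwq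
    have hσt : σ ≠ ⊤ := fun h => by
      have := hσ.2 h
      rw [hwe, edist_eq_zero] at this
      exact hwq this.symm
    have hsD : 1 ≤ σ.toReal * dist w q ^ 2 := by
      have h := hσ.1
      rw [hwe, edist_dist, dist_comm, ← ENNReal.ofReal_pow hD.le,
        ← ENNReal.ofReal_inv_of_pos (by positivity)] at h
      have h' := ENNReal.toReal_mono hσt h
      rw [ENNReal.toReal_ofReal (by positivity)] at h'
      exact (inv_le_iff_one_le_mul₀ (by positivity)).1 h'
    set x := σ.toReal * dist w q ^ 2 with hx
    have hQ0 : (0 : ℝ) < Q.card := by exact_mod_cast Finset.card_pos.2 ⟨v, hv⟩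
    have hQlog : 0 ≤ Real.log Q.card :=
      Real.log_nonneg (by exact_mod_cast Finset.card_pos.2 ⟨v, hv⟩)
    calc votingPower shard σ q Q i
        ≤ ∑ p ∈ Q.filter (fun x => shard x = i), ENNReal.ofReal (Real.exp (-(a ^ 2 * x))) := by
          refine Finset.sum_le_sum fun p hp => ?_
          rw [vote_of_ne_top hσt]
          refine ENNReal.ofReal_le_ofReal (Real.exp_le_exp.2 (neg_le_neg ?_))
          have h1 := pow_le_pow_left₀ (by positivity) (hfar' p hp).le 2
          calc a ^ 2 * x = σ.toReal * (a * dist w q) ^ 2 := by rw [hx]; ring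
            _ ≤ σ.toReal * dist p q ^ 2 := by gcongr
      _ ≤ ENNReal.ofReal (Q.card * Real.exp (-(a ^ 2 * x))) := by
          rw [Finset.sum_const, nsmul_eq_mul, ENNReal.ofReal_mul (by positivity),
            ENNReal.ofReal_natCast]
          gcongr
          exact Finset.filter_subset _ _
      _ < ENNReal.ofReal (Real.exp (-x)) := by
          rw [ENNReal.ofReal_lt_ofReal_iff (Real.exp_pos _)]
          nth_rewrite 1 [← Real.exp_log hQ0]
          rw [← Real.exp_add]
          refine Real.exp_lt_exp.2 ?_
          nlinarith
      _ = vote σ q w := by rw [vote_of_ne_top hσt]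

end Ranking

section Failure

variable {X : Type*} [MetricSpace X]

lemma isProbabilityMeasure_hashLaw {X : Type*} (H : Measure (X → Bool)) [IsProbabilityMeasure H]
    (r t : ℕ) : IsProbabilityMeasure (hashLaw H r t) := by
  unfold hashLaw; infer_instance

/-- Only two events can make the routing fail: the sample `R` misses all points within distance `u`
of `q`, or the index on `R` retrieves only points farther than `g` from `q`. -/
lemma failProb_le (H : Measure (X → Bool)) [IsProbabilityMeasure H] {r t m W s : ℕ}
    {P : Finset X} (hmP : m ≤ P.card) {shard : X → Fin s} {Top : Finset X → Fin s → Prop} {q : X}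
    {u g u' η ζ : ℝ} (hη0 : 0 ≤ η)
    (hTop : ∀ (Q : Finset X) (i : Fin s), Q.card ≤ r * (2 * W + 1) → Top Q i →
      (∃ v ∈ Q, dist v q ≤ g) → ∃ p ∈ Q, shard p = i ∧ dist p q ≤ u')
    (hη : ∀ R ⊆ P, (∃ p ∈ R, dist p q ≤ u) → hashLaw H r t
      {h | ∃ Q : Finset X, IsRetrieved h R W q Q ∧ ∀ v ∈ Q, g < dist v q} ≤ ENNReal.ofReal η)
    (hζ0 : 0 ≤ ζ) (hζ : (((P.filter fun p => ¬ dist p q ≤ u).powersetCard m).card : ℝ) ≤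
      ζ * (P.powersetCard m).card) :
    failProb H r t P m W shard Top q u' ≤ ENNReal.ofReal (ζ + η) := by
  classical
  have hprob := isProbabilityMeasure_hashLaw H r t
  set 𝓡 := P.powersetCard m with h𝓡
  set B := (P.filter fun p => ¬ dist p q ≤ u).powersetCard m with hB
  have hterm : ∀ R ∈ 𝓡, hashLaw H r t {h | Misrouted h P R W shard Top q u'} ≤
      (if R ∈ B then 1 else 0) + ENNReal.ofReal η := by
    intro R hR
    rw [h𝓡, Finset.mem_powersetCard] at hR
    split_ifs with hRB
    · exact prob_le_one.trans (by simp)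
    · have hnear : ∃ p ∈ R, dist p q ≤ u := by
        by_contra! hall
        exact hRB (Finset.mem_powersetCard.2 ⟨fun p hp =>
          Finset.mem_filter.2 ⟨hR.1 hp, not_le.2 (hall p hp)⟩, hR.2⟩)
      rw [zero_add]
      refine (measure_mono ?_).trans (hη R hR.1 hnear)
      rintro h ⟨Q, i, hQ, hQi, hmiss⟩
      refine ⟨Q, hQ, ?_⟩
      by_contra! hv
      obtain ⟨p, hp, hpi, hpu⟩ := hTop Q i hQ.card_le hQi hv
      exact absurd (hmiss p (hR.1 (hQ.subset hp)) hpi) (not_lt.2 hpu)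
  have hBsub : B ⊆ 𝓡 := Finset.powersetCard_mono (Finset.filter_subset _ _)
  have hpos : 0 < 𝓡.card := by
    rw [h𝓡, Finset.card_powersetCard]
    exact Nat.choose_pos hmP
  rw [failProb, ← h𝓡]
  refine ENNReal.div_le_of_le_mul ?_
  calc ∑ R ∈ 𝓡, hashLaw H r t {h | Misrouted h P R W shard Top q u'}
      ≤ ∑ R ∈ 𝓡, ((if R ∈ B then 1 else 0) + ENNReal.ofReal η) := Finset.sum_le_sum hterm
    _ = B.card + 𝓡.card * ENNReal.ofReal η := by
        rw [Finset.sum_add_distrib, Finset.sum_ite_mem, Finset.inter_eq_right.2 hBsub]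
        simp
    _ ≤ ENNReal.ofReal ζ * 𝓡.card + ENNReal.ofReal η * 𝓡.card := by
        rw [mul_comm (ENNReal.ofReal η)]
        gcongr
        rw [← ENNReal.ofReal_natCast, ← ENNReal.ofReal_natCast, ← ENNReal.ofReal_mul hζ0]
        exact ENNReal.ofReal_le_ofReal hζ
    _ = ENNReal.ofReal (ζ + η) * 𝓡.card := by rw [ENNReal.ofReal_add hζ0 hη0, add_mul]

lemma failProb_le_one (H : Measure (X → Bool)) [IsProbabilityMeasure H] {r t m W s : ℕ}
    {P : Finset X} {shard : X → Fin s} {Top : Finset X → Fin s → Prop} {q : X} {u' : ℝ} :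
    failProb H r t P m W shard Top q u' ≤ 1 := by
  have hprob := isProbabilityMeasure_hashLaw H r t
  rw [failProb]
  refine ENNReal.div_le_of_le_mul ?_
  rw [one_mul]
  calc _ ≤ ∑ R ∈ P.powersetCard m, (1 : ℝ≥0∞) := Finset.sum_le_sum fun R _ => prob_le_one
    _ = _ := by simp

/-- A lower bound on the distances between distinct points of a finite set. -/
lemma exists_separation (P : Finset X) :
    ∃ ε : ℝ, 0 < ε ∧ ∀ x ∈ P, ∀ y ∈ P, x ≠ y → ε ≤ dist x y := by
  classical
  rcases P.offDiag.eq_empty_or_nonempty with h | h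
  · refine ⟨1, one_pos, fun x hx y hy hxy => ?_⟩
    have := (Finset.mem_offDiag (x := (x, y))).2 ⟨hx, hy, hxy⟩
    rw [h] at this
    simp at this
  · obtain ⟨z, hz, hmin⟩ := Finset.exists_min_image _ (fun z : X × X => dist z.1 z.2) h
    exact ⟨dist z.1 z.2, dist_pos.2 (Finset.mem_offDiag.1 hz).2.2, fun x hx y hy hxy =>
      hmin (x, y) ((Finset.mem_offDiag (x := (x, y))).2 ⟨hx, hy, hxy⟩)⟩

/-- The failure probability of a ranking scheme `Top`, for a locality sensitive family and long
enough keys. The hypothesis on `Top` says that a retrieved point within distance `48 C c π_k(q)`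
guarantees success. -/
lemma failProb_bounds {H : Measure (X → Bool)} [IsProbabilityMeasure H] {C Δ lam c ε : ℝ}
    (hC : 1 ≤ C) (hc : 1 < c) (hlam : 0 < lam)
    (hH : ∀ x y : X, 1 - lam * dist x y ≤ H.real {h | h x = h y} ∧
      H.real {h | h x = h y} ≤ 1 - lam * min (dist x y) Δ / C)
    {P : Finset X} (hΔ : ∀ x ∈ P, ∀ y ∈ P, dist x y ≤ Δ) (hε : 0 < ε)
    (hsep : ∀ x ∈ P, ∀ y ∈ P, x ≠ y → ε ≤ dist x y) (hP : P.Nonempty) {t : ℕ}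
    (ht : 6 * C * Real.log P.card ≤ lam * ε * t) {κ W s : ℕ} {shard : X → Fin s}
    {Top : Finset X → Fin s → Prop} {q : X} {α : ℝ}
    (hTop : ∀ (g : ℝ) (Q : Finset X) (i : Fin s),
      Q.card ≤ ⌈4 * c * (κ + 4) * (P.card : ℝ) ^ (1 / c)⌉₊ * (2 * W + 1) → 0 ≤ g →
      Top Q i → (∃ v ∈ Q, dist v q ≤ 48 * C * c * g) → ∃ p ∈ Q, shard p = i ∧ dist p q ≤ α * g) :
    failProb H ⌈4 * c * (κ + 4) * (P.card : ℝ) ^ (1 / c)⌉₊ t P P.card W shard Top q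
        (α * kthDist P q 1) ≤ ENNReal.ofReal (1 / (P.card : ℝ) ^ κ) ∧
    ∀ m : ℕ, 1 ≤ m → m < P.card → ∀ δ : ℝ, 0 < δ → δ < 1 →
      ∀ k : ℕ, k = ⌈Real.log δ⁻¹ * ((P.card : ℝ) / m)⌉₊ → k ≤ P.card →
        failProb H ⌈4 * c * (κ + 4) * (P.card : ℝ) ^ (1 / c)⌉₊ t P m W shard Top q
          (α * kthDist P q k) ≤ ENNReal.ofReal (max δ (1 / (P.card : ℝ) ^ κ)) := by
  have hn1 : 1 ≤ P.card := Finset.card_pos.2 hP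
  have hfar : ∀ k, 1 ≤ k → 2 ≤ P.card → ∀ R ⊆ P, (∃ p ∈ R, dist p q ≤ kthDist P q k) → _ :=
    fun k hk hn R hRP ⟨p, hp, hpq⟩ => hashLaw_far_le hC hc hlam hH hΔ hε hsep hn ht hRP hp
      (kthDist_nonneg hk q) hpq κ W
  constructor
  · rcases hn1.eq_or_lt with h1 | hn
    · refine (failProb_le_one H).trans_eq ?_
      simp [← h1]
    · have hn1' : (1 : ℝ) ≤ P.card := by exact_mod_cast hn1
      -- the sample is all of `P`, which contains the nearest neighbor
      have hempty :
          ((P.filter fun p => ¬ dist p q ≤ kthDist P q 1).powersetCard P.card).card = 0 := by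
        rw [Finset.card_powersetCard, Nat.choose_eq_zero_iff]
        have h1 := Finset.card_filter_add_card_filter_not (s := P) fun p => dist p q ≤ kthDist P q 1
        have h2 := le_card_filter_kthDist hn1 q
        omega
      refine (failProb_le H le_rfl (by positivity)
        (fun Q i hQ => hTop _ Q i hQ (kthDist_nonneg le_rfl q))
        (hfar 1 le_rfl hn) le_rfl ?_).trans (ENNReal.ofReal_le_ofReal ?_)
      · rw [hempty]
        simp
      · rw [zero_add]
        exact one_div_le_one_div_of_le (by positivity) (pow_le_pow_right₀ hn1' (by omega))
  · intro m hm hmP δ hδ0 hδ1 k hk hkP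
    have hn : 2 ≤ P.card := by omega
    have hn2 : (2 : ℝ) ≤ P.card := by exact_mod_cast hn
    have hn0 : (0 : ℝ) < P.card := by linarith
    have hm0 : (0 : ℝ) < m := by exact_mod_cast hm
    have hk1 : 1 ≤ k := by
      rw [hk, Nat.one_le_ceil_iff]
      exact mul_pos (Real.log_pos ((one_lt_inv₀ hδ0).2 hδ1)) (by positivity)
    have hslack : 0 ≤ 1 - 1 / (4 * (P.card : ℝ) ^ 2) := by
      rw [sub_nonneg, div_le_one (by positivity)]
      nlinarith
    refine (failProb_le H hmP.le (by positivity)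
      (fun Q i hQ => hTop _ Q i hQ (kthDist_nonneg hk1 q))
      (hfar k hk1 hn) (mul_nonneg hslack hδ0.le) (card_powersetCard_miss_le hm hmP.le hδ0 hk1
        (by rw [hk]; exact Nat.le_ceil _) hkP q)).trans (ENNReal.ofReal_le_ofReal ?_)
    -- the slack in the sampling absorbs the failure probability of the hashing
    set M := max δ (1 / (P.card : ℝ) ^ κ) with hM
    have hη : 1 / (P.card : ℝ) ^ (κ + 4) ≤ 1 / (4 * (P.card : ℝ) ^ 2) * M := by
      calc 1 / (P.card : ℝ) ^ (κ + 4)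
          = 1 / ((P.card : ℝ) ^ 2 * (P.card : ℝ) ^ 2) * (1 / (P.card : ℝ) ^ κ) := by
            rw [div_mul_div_comm, one_mul]
            congr 1
            ring
        _ ≤ 1 / (4 * (P.card : ℝ) ^ 2) * M := by
            gcongr
            · nlinarith
            · exact le_max_right _ _
    have := mul_le_mul_of_nonneg_left (le_max_left δ (1 / (P.card : ℝ) ^ κ)) hslack
    linarith

end Failure

end SortLSH

theorem theorem1 :
    -- universal constants
    ∃ A C : ℝ, 0 < A ∧ 1 ≤ C ∧
    ∀ (c : ℝ), 1 < c → ∀ κ : ℕ, ∃ B : ℝ, 0 < B ∧ ∀ W : ℕ, 1 ≤ W → ∃ N : ℕ,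
    ∀ (ρ : ℝ≥0∞) [Fact (1 ≤ ρ)], ρ ≤ 2 →
    ∀ (d : ℕ) (P : Finset (SortLSH.LpSpace ρ d)), P.Nonempty →
    ∃ (H : Measure (SortLSH.LpSpace ρ d → Bool)) (t : ℕ),
      SortLSH.IsLSHFamily H C (Metric.diam (P : Set (SortLSH.LpSpace ρ d))) ∧
      ∀ (s : ℕ) (shard : SortLSH.LpSpace ρ d → Fin s) (q : SortLSH.LpSpace ρ d),
        -- no subsampling, `m = n`
        (SortLSH.failProb H ⌈B * (P.card : ℝ) ^ (1 / c)⌉₊ t P P.card W shard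
            (SortLSH.TopByDistance shard q) q (A * c * SortLSH.kthDist P q 1)
          ≤ ENNReal.ofReal (1 / (P.card : ℝ) ^ κ)) ∧
        (N ≤ P.card →
          SortLSH.failProb H ⌈B * (P.card : ℝ) ^ (1 / c)⌉₊ t P P.card W shard
            (SortLSH.TopByVotes shard q) q
            (A * √(c * Real.log P.card) * SortLSH.kthDist P q 1)
          ≤ ENNReal.ofReal (1 / (P.card : ℝ) ^ κ)) ∧
        -- subsampling, `m < n`
        ∀ m : ℕ, 1 ≤ m → m < P.card → ∀ δ : ℝ, 0 < δ → δ < 1 →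
        ∀ k : ℕ, k = ⌈Real.log δ⁻¹ * ((P.card : ℝ) / m)⌉₊ → k ≤ P.card →
          (SortLSH.failProb H ⌈B * (P.card : ℝ) ^ (1 / c)⌉₊ t P m W shard
              (SortLSH.TopByDistance shard q) q (A * c * SortLSH.kthDist P q k)
            ≤ ENNReal.ofReal (max δ (1 / (P.card : ℝ) ^ κ))) ∧
          (N ≤ P.card →
            SortLSH.failProb H ⌈B * (P.card : ℝ) ^ (1 / c)⌉₊ t P m W shard
              (SortLSH.TopByVotes shard q) q
              (A * √(c * Real.log P.card) * SortLSH.kthDist P q k)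
            ≤ ENNReal.ofReal (max δ (1 / (P.card : ℝ) ^ κ))) := by
  refine ⟨2 * (48 * 960), 960, by norm_num, by norm_num, fun c hc κ => ?_⟩
  have hc0 : 0 < c := by linarith
  refine ⟨4 * c * (κ + 4), by positivity, fun W _ => ?_⟩
  -- for `n ≥ N`, the logarithm of the number of retrieved points is at most `(2 / c) log n - 1`
  set K : ℝ := (4 * c * (κ + 4) + 1) * (2 * W + 1) with hK
  have hK1 : 1 ≤ K := by
    have h1 : (1 : ℝ) ≤ 4 * c * (κ + 4) + 1 := by
      have : 0 ≤ 4 * c * ((κ : ℝ) + 4) := by positivity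
      linarith
    have h2 : (1 : ℝ) ≤ 2 * W + 1 := by
      have : (0 : ℝ) ≤ W := Nat.cast_nonneg W
      linarith
    nlinarith
  refine ⟨⌈Real.exp (c * (1 + Real.log K))⌉₊, fun ρ _ hρ d P hP => ?_⟩
  obtain ⟨H, hLSH⟩ := SortLSH.exists_isLSHFamily ρ hρ d
    (Metric.diam (P : Set (SortLSH.LpSpace ρ d)))
  have hprob := hLSH.isProbabilityMeasure
  obtain ⟨lam, hlam, hH⟩ := hLSH.sensitive
  obtain ⟨ε, hε, hsep⟩ := SortLSH.exists_separation P
  have hΔ : ∀ x ∈ P, ∀ y ∈ P, dist x y ≤ Metric.diam (P : Set (SortLSH.LpSpace ρ d)) :=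
    fun x hx y hy => Metric.dist_le_diam_of_mem P.finite_toSet.isBounded hx hy
  -- keys long enough to separate all points of `P`
  set t := ⌈6 * 960 * Real.log P.card / (lam * ε)⌉₊ with ht
  have ht' : 6 * 960 * Real.log P.card ≤ lam * ε * t := by
    have h := Nat.le_ceil (6 * 960 * Real.log P.card / (lam * ε))
    rw [← ht, div_le_iff₀ (by positivity)] at h
    linarith
  refine ⟨H, t, hLSH, fun s shard q => ?_⟩
  have hD := SortLSH.failProb_bounds (by norm_num) hc hlam hH hΔ hε hsep hP ht' (κ := κ) (W := W)
    (shard := shard) (Top := SortLSH.TopByDistance shard q) (q := q) (α := 2 * (48 * 960) * c)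
    (fun g Q i _ hg hTop ⟨v, hv, hvg⟩ =>
      hTop.exists_near hv (hvg.trans (by nlinarith [mul_nonneg hc0.le hg])))
  have hV := fun hN : ⌈Real.exp (c * (1 + Real.log K))⌉₊ ≤ P.card =>
    SortLSH.failProb_bounds (by norm_num) hc hlam hH hΔ hε hsep hP ht' (κ := κ) (W := W)
    (shard := shard) (Top := SortLSH.TopByVotes shard q) (q := q)
    (α := 2 * (48 * 960) * √(c * Real.log P.card)) (by
      intro g Q i hQ hg hTop ⟨v, hv, hvg⟩
      have hn1 : (1 : ℝ) ≤ P.card := by exact_mod_cast Finset.card_pos.2 hP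
      have hL : c * (1 + Real.log K) ≤ Real.log P.card := by
        rw [Real.le_log_iff_exp_le (by linarith)]
        exact Nat.ceil_le.1 hN
      have hlogK : 0 ≤ Real.log K := Real.log_nonneg hK1
      set L := Real.log P.card with hLdef
      have hL0 : 0 < L := lt_of_lt_of_le (by positivity) hL
      have hQcard : (Q.card : ℝ) ≤ K * (P.card : ℝ) ^ (1 / c) := by
        have h1 : (1 : ℝ) ≤ (P.card : ℝ) ^ (1 / c) := Real.one_le_rpow hn1 (by positivity)
        have h2 := (Nat.ceil_lt_add_one (show 0 ≤ 4 * c * (κ + 4) * (P.card : ℝ) ^ (1 / c) by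
          positivity)).le
        calc (Q.card : ℝ) ≤ (⌈4 * c * (κ + 4) * (P.card : ℝ) ^ (1 / c)⌉₊ : ℝ) * (2 * W + 1) := by
              exact_mod_cast hQ
          _ ≤ ((4 * c * (κ + 4) + 1) * (P.card : ℝ) ^ (1 / c)) * (2 * W + 1) := by
              gcongr
              linarith
          _ = K * (P.card : ℝ) ^ (1 / c) := by rw [hK]; ring
      have hQ0 : (0 : ℝ) < Q.card := by exact_mod_cast Finset.card_pos.2 ⟨v, hv⟩
      have hlogQ : Real.log Q.card ≤ Real.log K + L / c := by
        refine (Real.log_le_log hQ0 hQcard).trans_eq ?_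
        rw [Real.log_mul (by linarith) (by positivity), Real.log_rpow (by linarith), ← hLdef]
        ring
      have hsq : (2 * √(c * L) / c) ^ 2 = 4 * (L / c) := by
        rw [div_pow, mul_pow, Real.sq_sqrt (by positivity)]
        field_simp
        ring
      have hLc : 1 + Real.log K ≤ L / c := by
        rw [le_div_iff₀ hc0]
        linarith
      obtain ⟨p, hp, hpi, hpd⟩ := hTop.exists_near (a := 2 * √(c * L) / c) hv hvg (by positivity)
        (by
          rw [hsq]
          have : 0 < L / c := by positivity
          linarith)
      refine ⟨p, hp, hpi, hpd.trans_eq ?_⟩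
      field_simp)
  exact ⟨hD.1, fun hN => (hV hN).1, fun m hm hmP δ hδ0 hδ1 k hk hkP =>
    ⟨hD.2 m hm hmP δ hδ0 hδ1 k hk hkP, fun hN => (hV hN).2 m hm hmP δ hδ0 hδ1 k hk hkP⟩⟩
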